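/- Let $p$ be a prime, $k$ a perfect field of characteristic $p$, and let $n\ge 0$ and $h>N\ge 0$ be integers. For a perfect $k$-algebra $R$ let $W(R)$ be its ring of $p$-typical Witt vectors and $W_h(R)$ the ring of Witt vectors of length $h$. Consider the following two functors on perfect $k$-algebras. (a) $\overline{\mathrm{Gr}}_{N,h}(R)$ is the set of isomorphism classes of triples $(\mathcal E,\beta,\bar\epsilon)$, where $\mathcal E$ is a finite projective $W(R)$-module of rank $n$, $\beta:\mathcal E\to W(R)^n$ is a $W(R)$-linear map such that $\wedge^n\beta$ is an isomorphism of $\wedge^n\mathcal E$ onto $p^N\wedge^nW(R)^n=p^NW(R)$, and $\bar\epsilon:W_h(R)^n\simeq \mathcal E\otimes_{W(R)}W_h(R)$ is an isomorphism of $W_h(R)$-modules; functoriality is by base change. (b) $V_{N,h}(R)$ is the set of $n\times n$ matrices $A$ over $W_h(R)$ whose determinant has Witt components $(\det_0A,\dots,\det_{h-1}A)$ with $\det_0A=\cdots=\det_{N-1}A=0$ and $\det_NA\in R^\times$, and the stabilizer scheme $J$ is given by $$J(R)=\{(A,\gamma)\in V_{N,h}(R)\times \mathrm{GL}_n(W_h(R))\mid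 A\gamma=A\}.$$ Then there is an isomorphism of functors $J\simeq\overline{\mathrm{Gr}}_{N,h}$ over $V_{N,h}$, that is, compatible with the maps $(A,\gamma)\mapsto A$ and $(\mathcal E,\beta,\bar\epsilon)\mapsto(\beta|_{W_h(R)})\circ\bar\epsilon$. In particular, $\overline{\mathrm{Gr}}_{N,h}$ is represented by a perfect affine scheme perfectly of finite type: there is a perfect $k$-algebra $\mathcal A$, the perfection of a $k$-algebra of finite type, such that $\overline{\mathrm{Gr}}_{N,h}(R)\cong\mathrm{Hom}_{k\text{-alg}}(\mathcal A,R)$ naturally in $R$. -/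

import Mathlib

open scoped TensorProduct
open CategoryTheory

universe u

namespace LevelGr

section
variable {A B E : Type*} [CommRing A] [CommRing B] [Algebra A B] [AddCommGroup E] [Module A E]

/-- The natural map `⋀ⁿ_A E → ⋀ⁿ_B (B ⊗ E)`. -/
noncomputable def wedgeBaseChange (A B E : Type*) [CommRing A] [CommRing B] [Algebra A B]
    [AddCommGroup E] [Module A E] (n : ℕ) : ⋀[A]^n E →ₗ[A] ⋀[B]^n (B ⊗[A] E) :=
  exteriorPower.alternatingMapLinearEquiv
    { toFun := fun m => exteriorPower.ιMulti B n (fun i => (1 : B) ⊗ₜ[A] m i)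
      map_update_add' := by
        intro _ m i x y
        have key : ∀ z : E, (fun j => (1 : B) ⊗ₜ[A] (Function.update m i z j)) =
            Function.update (fun j => (1 : B) ⊗ₜ[A] m j) i ((1 : B) ⊗ₜ[A] z) := by
          intro z; ext j; by_cases h : j = i <;> simp_all
        rw [key, key, key, TensorProduct.tmul_add, AlternatingMap.map_update_add]
      map_update_smul' := by
        intro _ m i c x
        have key : ∀ z : E, (fun j => (1 : B) ⊗ₜ[A] (Function.update m i z j)) =
            Function.update (fun j => (1 : B) ⊗ₜ[A] m j) i ((1 : B) ⊗ₜ[A] z) := by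
          intro z; ext j; by_cases h : j = i <;> simp_all
        rw [key, key, TensorProduct.tmul_smul, ← algebraMap_smul B c ((1 : B) ⊗ₜ[A] x),
          AlternatingMap.map_update_smul, algebraMap_smul]
      map_eq_zero_of_eq' := by
        intro v i j h hij
        exact AlternatingMap.map_eq_zero_of_eq _ _ (by simp [h]) hij }

theorem wedgeBaseChange_ιMulti (n : ℕ) (m : Fin n → E) :
    wedgeBaseChange A B E n (exteriorPower.ιMulti A n m) =
      exteriorPower.ιMulti B n (fun i => (1 : B) ⊗ₜ[A] m i) := by
  simp [wedgeBaseChange, -exteriorPower.ιMulti_apply_coe]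

theorem wedgeBaseChange_range (n : ℕ) :
    Submodule.span B (Set.range (wedgeBaseChange A B E n)) = ⊤ := by
  have hs : Submodule.span B (Set.range fun x : E => (1 : B) ⊗ₜ[A] x) = ⊤ := by
    have h := TensorProduct.span_tmul_eq_top A B E
    rw [eq_top_iff]
    rintro z -
    induction z using TensorProduct.induction_on with
    | zero => exact zero_mem _
    | tmul b x =>
      have : b ⊗ₜ[A] x = b • ((1 : B) ⊗ₜ[A] x) := by simp [TensorProduct.smul_tmul']
      rw [this]
      exact Submodule.smul_mem _ _ (Submodule.subset_span ⟨x, rfl⟩)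
    | add x y hx hy => exact add_mem hx hy
  have h2 := exteriorPower.ιMulti_span_of_span (R := B) (n := n) (M := B ⊗[A] E) hs
  rw [eq_top_iff, ← h2]
  apply Submodule.span_mono
  rintro _ ⟨a, ha, rfl⟩
  choose m hm using fun i => ha (Set.mem_range_self i)
  refine ⟨exteriorPower.ιMulti A n m, ?_⟩
  rw [wedgeBaseChange_ιMulti]
  congr 1
  ext i
  exact hm i

/-- `e₁ ∧ ⋯ ∧ eₙ` -/
noncomputable abbrev topForm (A : Type*) [CommRing A] (n : ℕ) : ⋀[A]^n (Fin n → A) :=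
  exteriorPower.ιMulti A n (Pi.basisFun A (Fin n))

theorem span_topForm (n : ℕ) : Submodule.span A {topForm A n} = ⊤ := by
  rw [eq_top_iff, ← exteriorPower.ιMulti_span, Submodule.span_le]
  rintro _ ⟨m, rfl⟩
  have : exteriorPower.ιMulti A n =
      ((LinearMap.toSpanSingleton A _ (topForm A n)).compAlternatingMap
        (Pi.basisFun A (Fin n)).det) := by
    refine Module.Basis.ext_alternating (Pi.basisFun A (Fin n)) fun i h => ?_
    let σ : Equiv.Perm (Fin n) := Equiv.ofBijective i (Finite.injective_iff_bijective.1 h)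
    change exteriorPower.ιMulti A n (Pi.basisFun A (Fin n) ∘ σ) =
      LinearMap.toSpanSingleton A _ (topForm A n)
        ((Pi.basisFun A (Fin n)).det (Pi.basisFun A (Fin n) ∘ σ))
    rw [AlternatingMap.map_perm, AlternatingMap.map_perm, Module.Basis.det_self]
    simp [topForm, -exteriorPower.ιMulti_apply_coe]
  rw [this]
  exact Submodule.mem_span_singleton.2 ⟨_, rfl⟩

theorem smul_topForm_eq_zero {n : ℕ} {b : A} (h : b • topForm A n = 0) : b = 0 := by
  have := congrArg (exteriorPower.alternatingMapLinearEquiv (Pi.basisFun A (Fin n)).det) h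
  rw [map_smul, exteriorPower.alternatingMapLinearEquiv_apply_ιMulti, map_zero,
    Module.Basis.det_self, smul_eq_mul, mul_one] at this
  exact this

/-- `⋀ⁿβ` is an isomorphism of `⋀ⁿ E` onto the submodule `d • ⋀ⁿ Aⁿ` of `⋀ⁿ Aⁿ`. -/
def WedgeIsoOnto {n : ℕ} (β : E →ₗ[A] (Fin n → A)) (d : A) : Prop :=
  Function.Injective (exteriorPower.map n β) ∧
    LinearMap.range (exteriorPower.map n β) = Ideal.span {d} • (⊤ : Submodule A (⋀[A]^n (Fin n → A)))

/-- The base change `B ⊗ E → Bⁿ` of `β : E → Aⁿ`, where `B ⊗ Aⁿ` is identified with `Bⁿ`. -/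
noncomputable def coordBaseChange (B : Type*) [CommRing B] [Algebra A B] {n : ℕ} (β : E →ₗ[A] (Fin n → A)) :
    B ⊗[A] E →ₗ[B] (Fin n → B) :=
  (TensorProduct.piScalarRight A B B (Fin n)).toLinearMap ∘ₗ β.baseChange B

theorem map_wedgeBaseChange {n : ℕ} (β : E →ₗ[A] (Fin n → A)) (x : ⋀[A]^n E) (c : A)
    (hx : exteriorPower.map n β x = c • topForm A n) :
    exteriorPower.map n (coordBaseChange B β) (wedgeBaseChange A B E n x) =
      algebraMap A B c • topForm B n := by
  have h1 : ∀ x, exteriorPower.map n (coordBaseChange B β) (wedgeBaseChange A B E n x) =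
      exteriorPower.map n (TensorProduct.piScalarRight A B B (Fin n)).toLinearMap
        (wedgeBaseChange A B _ n (exteriorPower.map n β x)) := by
    intro x
    have : x ∈ Submodule.span A (Set.range (exteriorPower.ιMulti A n (M := E))) := by
      rw [exteriorPower.ιMulti_span]; trivial
    induction this using Submodule.span_induction with
    | mem x h =>
      obtain ⟨m, rfl⟩ := h
      simp only [wedgeBaseChange_ιMulti, exteriorPower.map_apply_ιMulti]
      congr 1
    | zero => simp
    | add x y _ _ hx hy => simp [hx, hy]
    | smul a x _ hx =>
      rw [map_smul (wedgeBaseChange A B E n), map_smul (exteriorPower.map n β),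
        map_smul (wedgeBaseChange A B (Fin n → A) n), ← algebraMap_smul B a,
        ← algebraMap_smul B a (wedgeBaseChange A B (Fin n → A) n _), map_smul, map_smul, hx]
  rw [h1, hx, map_smul, ← algebraMap_smul B c, map_smul, wedgeBaseChange_ιMulti,
    exteriorPower.map_apply_ιMulti]
  congr 2
  ext i j
  simp [Pi.single_apply]

theorem WedgeIsoOnto.baseChange {n : ℕ} {β : E →ₗ[A] (Fin n → A)} {d : A} (h : WedgeIsoOnto β d)
    (hd : algebraMap A B d ∈ nonZeroDivisors B) :
    WedgeIsoOnto (coordBaseChange B β) (algebraMap A B d) := by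
  obtain ⟨hi, hr⟩ := h
  rw [← span_topForm, Submodule.ideal_span_singleton_smul] at hr
  have hmem : d • topForm A n ∈ LinearMap.range (exteriorPower.map n β) := by
    rw [hr]
    exact Submodule.smul_mem_pointwise_smul _ _ _ (Submodule.mem_span_singleton_self _)
  obtain ⟨v, hv⟩ := hmem
  have hgen : ∀ x : ⋀[A]^n E, ∃ a : A, x = a • v := by
    intro x
    have hx : exteriorPower.map n β x ∈ LinearMap.range (exteriorPower.map n β) := ⟨x, rfl⟩
    rw [hr] at hx
    obtain ⟨y, hy, hxy⟩ := hx
    obtain ⟨a, rfl⟩ := Submodule.mem_span_singleton.1 hy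
    refine ⟨a, hi ?_⟩
    rw [map_smul, hv, ← hxy]
    exact smul_comm _ _ _
  set v' := wedgeBaseChange A B E n v with hv'
  have hgen' : Submodule.span B {v'} = ⊤ := by
    rw [eq_top_iff, ← wedgeBaseChange_range, Submodule.span_le]
    rintro _ ⟨x, rfl⟩
    obtain ⟨a, rfl⟩ := hgen x
    rw [map_smul, ← algebraMap_smul B a]
    exact Submodule.mem_span_singleton.2 ⟨_, rfl⟩
  have himg : exteriorPower.map n (coordBaseChange B β) v' = algebraMap A B d • topForm B n :=
    map_wedgeBaseChange β v d hv
  constructor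
  · rw [injective_iff_map_eq_zero]
    intro y hy
    obtain ⟨b, rfl⟩ := Submodule.mem_span_singleton.1 (hgen' ▸ Submodule.mem_top : y ∈ Submodule.span B {v'})
    rw [map_smul, himg, smul_smul] at hy
    have := smul_topForm_eq_zero hy
    rw [(mul_right_mem_nonZeroDivisors_eq_zero_iff hd).1 this, zero_smul]
  · rw [LinearMap.range_eq_map, ← hgen', Submodule.map_span, Set.image_singleton, himg,
      ← span_topForm, Submodule.ideal_span_singleton_smul, Submodule.smul_span,
      Set.smul_set_singleton]
end

/-- Triples `(E, β, ε)` over a ring map `A → Ah`: a finite projective `A`-module `E` of constant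
rank `n`, a map `β : E → Aⁿ` with `⋀ⁿβ : ⋀ⁿE ≃ d ⋀ⁿAⁿ`, and a trivialization `ε : Ahⁿ ≃ Ah ⊗ E` of
the restriction of `E` to `Ah`. Below, `A = W(R)`, `Ah = W_h(R)` and `d = p ^ N`. -/
structure LevelTriple (A Ah : Type u) [CommRing A] [CommRing Ah] [Algebra A Ah] (n d : ℕ) where
  E : Type u
  [addCommGroup : AddCommGroup E]
  [module : Module A E]
  [finite : Module.Finite A E]
  [projective : Module.Projective A E]
  rank_eq : ∀ q : PrimeSpectrum A, Module.rankAtStalk E q = n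
  β : E →ₗ[A] (Fin n → A)
  wedge : WedgeIsoOnto β (d : A)
  ε : (Fin n → Ah) ≃ₗ[Ah] Ah ⊗[A] E

attribute [instance] LevelTriple.addCommGroup LevelTriple.module LevelTriple.finite
  LevelTriple.projective

namespace LevelTriple

section
variable {A Ah : Type u} [CommRing A] [CommRing Ah] [Algebra A Ah] {n d : ℕ}

/-- Isomorphism of triples. -/
def Rel (T T' : LevelTriple A Ah n d) : Prop :=
  ∃ φ : T.E ≃ₗ[A] T'.E, (∀ x, T'.β (φ x) = T.β x) ∧
    ∀ v, (φ.toLinearMap.baseChange Ah) (T.ε v) = T'.ε v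

instance setoid (A Ah : Type u) [CommRing A] [CommRing Ah] [Algebra A Ah] (n d : ℕ) :
    Setoid (LevelTriple A Ah n d) where
  r := Rel
  iseqv :=
    { refl := fun T => ⟨LinearEquiv.refl A T.E, fun _ => rfl, fun v => by
        simp⟩
      symm := by
        rintro T T' ⟨φ, h1, h2⟩
        refine ⟨φ.symm, fun x => by rw [← h1, φ.apply_symm_apply], fun v => ?_⟩
        rw [← h2, ← LinearMap.comp_apply, ← LinearMap.baseChange_comp]
        simp
      trans := by
        rintro T T' T'' ⟨φ, h1, h2⟩ ⟨ψ, h3, h4⟩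
        refine ⟨φ.trans ψ, fun x => by simp [h3, h1], fun v => ?_⟩
        rw [← h4, ← h2, ← LinearMap.comp_apply, ← LinearMap.baseChange_comp]
        rfl }

/-- The matrix of the composite `Ahⁿ ≃ Ah ⊗ E → Ahⁿ` of `ε` with the restriction of `β` to `Ah`. -/
noncomputable def matrix (T : LevelTriple A Ah n d) : Matrix (Fin n) (Fin n) Ah :=
  LinearMap.toMatrix' (coordBaseChange Ah T.β ∘ₗ T.ε.toLinearMap)

theorem matrix_eq {T T' : LevelTriple A Ah n d} (h : Rel T T') : T.matrix = T'.matrix := by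
  obtain ⟨φ, h1, h2⟩ := h
  unfold matrix
  congr 1
  apply LinearMap.ext
  intro v
  simp only [LinearMap.comp_apply, LinearEquiv.coe_coe, ← h2, coordBaseChange]
  rw [← LinearMap.comp_apply (T'.β.baseChange Ah), ← LinearMap.baseChange_comp]
  congr 3
  ext x : 1
  exact (h1 x).symm
end

section
variable {A Ah B Bh : Type u} [CommRing A] [CommRing Ah] [CommRing B] [CommRing Bh]
  [Algebra A Ah] [Algebra B Bh] [Algebra A B] [Algebra Ah Bh] [Algebra A Bh]
  [IsScalarTower A B Bh] [IsScalarTower A Ah Bh] {n d : ℕ}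

/-- The canonical isomorphism `Bh ⊗ (Ah ⊗ E) ≃ Bh ⊗ (B ⊗ E)`. -/
noncomputable def compare (A Ah B Bh E : Type u) [CommRing A] [CommRing Ah] [CommRing B] [CommRing Bh]
    [Algebra A Ah] [Algebra B Bh] [Algebra A B] [Algebra Ah Bh] [Algebra A Bh]
    [IsScalarTower A B Bh] [IsScalarTower A Ah Bh] [AddCommGroup E] [Module A E] :
    Bh ⊗[Ah] (Ah ⊗[A] E) ≃ₗ[Bh] Bh ⊗[B] (B ⊗[A] E) :=
  (TensorProduct.AlgebraTensorModule.cancelBaseChange A Ah Bh Bh E).trans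
    (TensorProduct.AlgebraTensorModule.cancelBaseChange A B Bh Bh E).symm

/-- Base change of triples `(E, β, ε)` to `(B ⊗ E, B ⊗ β, Bh ⊗ ε)`. -/
noncomputable def baseChange (B Bh : Type u) [CommRing B] [CommRing Bh]
    [Algebra B Bh] [Algebra A B] [Algebra Ah Bh] [Algebra A Bh]
    [IsScalarTower A B Bh] [IsScalarTower A Ah Bh]
    (hd : (d : B) ∈ nonZeroDivisors B) (T : LevelTriple A Ah n d) : LevelTriple B Bh n d where
  E := B ⊗[A] T.E
  rank_eq q := by rw [Module.rankAtStalk_baseChange, T.rank_eq]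
  β := coordBaseChange B T.β
  wedge := by
    have := T.wedge.baseChange (B := B) (by rwa [map_natCast])
    rwa [map_natCast] at this
  ε := (TensorProduct.piScalarRight Ah Bh Bh (Fin n)).symm.trans
    ((T.ε.baseChange Ah Bh _ _).trans (compare A Ah B Bh T.E))

theorem compare_one_tmul {E : Type u} [AddCommGroup E] [Module A E] (a : Ah) (x : E) :
    compare A Ah B Bh E (1 ⊗ₜ (a ⊗ₜ x)) = algebraMap Ah Bh a ⊗ₜ (1 ⊗ₜ x) := by
  simp [compare, Algebra.smul_def]

theorem baseChange_ε_single (hd : (d : B) ∈ nonZeroDivisors B) (T : LevelTriple A Ah n d)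
    (i : Fin n) : (T.baseChange B Bh hd).ε (Pi.single i 1) =
      compare A Ah B Bh T.E (1 ⊗ₜ T.ε (Pi.single i 1)) := by
  change compare A Ah B Bh T.E (T.ε.baseChange Ah Bh _ _
    ((TensorProduct.piScalarRight Ah Bh Bh (Fin n)).symm (Pi.single i 1))) = _
  rw [TensorProduct.piScalarRight_symm_single]
  rfl

theorem Rel.of_single {T T' : LevelTriple A Ah n d} (φ : T.E ≃ₗ[A] T'.E)
    (h : ∀ x, T'.β (φ x) = T.β x)
    (h' : ∀ i, (φ.toLinearMap.baseChange Ah) (T.ε (Pi.single i 1)) = T'.ε (Pi.single i 1)) :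
    Rel T T' := by
  refine ⟨φ, h, fun v => ?_⟩
  have : φ.toLinearMap.baseChange Ah ∘ₗ T.ε.toLinearMap = T'.ε.toLinearMap := by
    apply LinearMap.pi_ext'
    intro i
    ext
    simpa using h' i
  exact LinearMap.congr_fun this v

theorem baseChange_compare {E E' : Type u} [AddCommGroup E] [Module A E] [AddCommGroup E']
    [Module A E'] (φ : E →ₗ[A] E') (z : Ah ⊗[A] E) :
    (φ.baseChange B).baseChange Bh (compare A Ah B Bh E (1 ⊗ₜ z)) =
      compare A Ah B Bh E' (1 ⊗ₜ φ.baseChange Ah z) := by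
  induction z using TensorProduct.induction_on with
  | zero => simp
  | tmul a x => simp [compare_one_tmul]
  | add x y hx hy => simp only [TensorProduct.tmul_add, map_add, hx, hy]

theorem Rel.baseChange (hd : (d : B) ∈ nonZeroDivisors B) {T T' : LevelTriple A Ah n d}
    (h : Rel T T') : Rel (T.baseChange B Bh hd) (T'.baseChange B Bh hd) := by
  obtain ⟨φ, h1, h2⟩ := h
  have h3 : T'.β ∘ₗ φ.toLinearMap = T.β := LinearMap.ext h1
  refine Rel.of_single (φ.baseChange A B _ _) (fun x => ?_) (fun i => ?_)
  · have : coordBaseChange B T'.β ∘ₗ φ.toLinearMap.baseChange B = coordBaseChange B T.β := by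
      rw [← h3, coordBaseChange, coordBaseChange, LinearMap.baseChange_comp, LinearMap.comp_assoc]
    exact LinearMap.congr_fun this x
  · rw [baseChange_ε_single, baseChange_ε_single, ← h2]
    exact baseChange_compare φ.toLinearMap _

theorem coordBaseChange_cancel {C : Type u} [CommRing C] [Algebra A C] [Algebra B C]
    [IsScalarTower A B C] {E : Type u} [AddCommGroup E] [Module A E] (β : E →ₗ[A] (Fin n → A))
    (x : C ⊗[A] E) :
    coordBaseChange C (coordBaseChange B β)
      ((TensorProduct.AlgebraTensorModule.cancelBaseChange A B C C E).symm x) =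
      coordBaseChange C β x := by
  induction x using TensorProduct.induction_on with
  | zero => simp
  | tmul a x =>
    ext i
    simp [coordBaseChange, Algebra.smul_def, ← IsScalarTower.algebraMap_apply]
  | add x y hx hy => rw [map_add, map_add, map_add, hx, hy]

theorem compare_compare {C Ch : Type u} [CommRing C] [CommRing Ch] [Algebra C Ch]
    [Algebra A C] [Algebra Ah Ch] [Algebra A Ch] [Algebra B C] [Algebra Bh Ch] [Algebra B Ch]
    [IsScalarTower A C Ch] [IsScalarTower A Ah Ch] [IsScalarTower B C Ch] [IsScalarTower B Bh Ch]
    [IsScalarTower A B C] [IsScalarTower Ah Bh Ch] {E : Type u} [AddCommGroup E] [Module A E]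
    (z : Ah ⊗[A] E) :
    (TensorProduct.AlgebraTensorModule.cancelBaseChange A B C C E).symm.toLinearMap.baseChange Ch
      (compare A Ah C Ch E (1 ⊗ₜ z)) =
      compare B Bh C Ch (B ⊗[A] E) (1 ⊗ₜ compare A Ah B Bh E (1 ⊗ₜ z)) := by
  induction z using TensorProduct.induction_on with
  | zero => simp
  | tmul a x => simp [compare_one_tmul, ← IsScalarTower.algebraMap_apply]
  | add x y hx hy => simp only [TensorProduct.tmul_add, map_add, hx, hy]

theorem baseChange_baseChange {C Ch : Type u} [CommRing C] [CommRing Ch] [Algebra C Ch]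
    [Algebra A C] [Algebra Ah Ch] [Algebra A Ch] [Algebra B C] [Algebra Bh Ch] [Algebra B Ch]
    [IsScalarTower A C Ch] [IsScalarTower A Ah Ch] [IsScalarTower B C Ch] [IsScalarTower B Bh Ch]
    [IsScalarTower A B C] [IsScalarTower Ah Bh Ch]
    (hd : (d : B) ∈ nonZeroDivisors B) (hd' : (d : C) ∈ nonZeroDivisors C)
    (T : LevelTriple A Ah n d) :
    Rel (T.baseChange C Ch hd') ((T.baseChange B Bh hd).baseChange C Ch hd') := by
  refine Rel.of_single
    (TensorProduct.AlgebraTensorModule.cancelBaseChange A B C C T.E).symm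
    (fun x => coordBaseChange_cancel T.β x) (fun i => ?_)
  rw [baseChange_ε_single, baseChange_ε_single, baseChange_ε_single]
  exact compare_compare _

end

theorem baseChange_self {A Ah : Type u} [CommRing A] [CommRing Ah] [i₃ : Algebra A Ah] {n d : ℕ}
    (hd : (d : A) ∈ nonZeroDivisors A) (T : LevelTriple A Ah n d) :
    Rel (T.baseChange A Ah hd) T := by
  refine Rel.of_single (TensorProduct.lid A T.E) (fun x => ?_) (fun i => ?_)
  · have : T.β ∘ₗ (TensorProduct.lid A T.E).toLinearMap = coordBaseChange A T.β := by
      ext x i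
      simp [coordBaseChange]
    exact LinearMap.congr_fun this x
  · rw [baseChange_ε_single]
    generalize T.ε (Pi.single i 1) = z
    have key : (TensorProduct.lid A T.E).toLinearMap.baseChange Ah
        (compare A Ah A Ah T.E (1 ⊗ₜ z)) = z := by
      induction z using TensorProduct.induction_on with
      | zero => simp
      | tmul a x => simp [compare_one_tmul]
      | add x y hx hy => rw [TensorProduct.tmul_add, map_add, map_add, hx, hy]
    exact key

theorem baseChange_self' {A Ah : Type u} [CommRing A] [CommRing Ah] {n d : ℕ}
    (j₁ : Algebra A A) (j₂ : Algebra Ah Ah) (j₃ : Algebra A Ah) [i₃ : Algebra A Ah]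
    (hd : (d : A) ∈ nonZeroDivisors A) (T : LevelTriple A Ah n d) (h₁ : j₁ = Algebra.id A) (h₂ : j₂ = Algebra.id Ah)
    (h₃ : j₃ = i₃) (t₁ : @IsScalarTower A A Ah j₁.toSMul i₃.toSMul j₃.toSMul)
    (t₂ : @IsScalarTower A Ah Ah i₃.toSMul j₂.toSMul j₃.toSMul) :
    Rel (@baseChange A Ah _ _ i₃ n d A Ah _ _ i₃ j₁ j₂ j₃ t₁ t₂ hd T) T := by
  subst h₁ h₂ h₃
  exact baseChange_self hd T

section
variable {A Ah B Bh C Ch : Type u} [CommRing A] [CommRing Ah] [CommRing B] [CommRing Bh]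
  [CommRing C] [CommRing Ch]
  [Algebra A Ah] [Algebra B Bh] [Algebra C Ch] {n d : ℕ}

/-- Base change along a commutative square of ring homomorphisms. -/
noncomputable def map (f : A →+* B) (g : Ah →+* Bh)
    (hfg : g.comp (algebraMap A Ah) = (algebraMap B Bh).comp f)
    (hd : (d : B) ∈ nonZeroDivisors B) (T : LevelTriple A Ah n d) : LevelTriple B Bh n d :=
  letI := f.toAlgebra
  letI := g.toAlgebra
  letI := ((algebraMap B Bh).comp f).toAlgebra
  haveI : IsScalarTower A B Bh := .of_algebraMap_eq fun _ => rfl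
  haveI : IsScalarTower A Ah Bh := .of_algebraMap_eq fun x => (RingHom.congr_fun hfg x).symm
  T.baseChange B Bh hd

theorem Rel.map (f : A →+* B) (g : Ah →+* Bh)
    (hfg : g.comp (algebraMap A Ah) = (algebraMap B Bh).comp f)
    (hd : (d : B) ∈ nonZeroDivisors B) {T T' : LevelTriple A Ah n d} (h : Rel T T') :
    Rel (T.map f g hfg hd) (T'.map f g hfg hd) :=
  letI := f.toAlgebra
  letI := g.toAlgebra
  letI := ((algebraMap B Bh).comp f).toAlgebra
  haveI : IsScalarTower A B Bh := .of_algebraMap_eq fun _ => rfl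
  haveI : IsScalarTower A Ah Bh := .of_algebraMap_eq fun x => (RingHom.congr_fun hfg x).symm
  h.baseChange hd

theorem map_map (f : A →+* B) (g : Ah →+* Bh)
    (hfg : g.comp (algebraMap A Ah) = (algebraMap B Bh).comp f)
    (hd : (d : B) ∈ nonZeroDivisors B) (f' : B →+* C) (g' : Bh →+* Ch)
    (hfg' : g'.comp (algebraMap B Bh) = (algebraMap C Ch).comp f')
    (hd' : (d : C) ∈ nonZeroDivisors C)
    (f'' : A →+* C) (g'' : Ah →+* Ch) (hf : f'' = f'.comp f) (hg : g'' = g'.comp g)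
    (hfg'' : g''.comp (algebraMap A Ah) = (algebraMap C Ch).comp f'')
    (T : LevelTriple A Ah n d) :
    Rel (T.map f'' g'' hfg'' hd') ((T.map f g hfg hd).map f' g' hfg' hd') := by
  subst hf hg
  let _ := f.toAlgebra
  let _ := g.toAlgebra
  let _ := ((algebraMap B Bh).comp f).toAlgebra
  have : IsScalarTower A B Bh := .of_algebraMap_eq fun _ => rfl
  have : IsScalarTower A Ah Bh := .of_algebraMap_eq fun x => (RingHom.congr_fun hfg x).symm
  let _ := f'.toAlgebra
  let _ := g'.toAlgebra
  let _ := ((algebraMap C Ch).comp f').toAlgebra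
  have : IsScalarTower B C Ch := .of_algebraMap_eq fun _ => rfl
  have : IsScalarTower B Bh Ch := .of_algebraMap_eq fun x => (RingHom.congr_fun hfg' x).symm
  let _ := (f'.comp f).toAlgebra
  let _ := (g'.comp g).toAlgebra
  let _ := ((algebraMap C Ch).comp (f'.comp f)).toAlgebra
  have : IsScalarTower A C Ch := .of_algebraMap_eq fun _ => rfl
  have : IsScalarTower A Ah Ch := .of_algebraMap_eq fun x => (RingHom.congr_fun hfg'' x).symm
  have : IsScalarTower A B C := .of_algebraMap_eq fun _ => rfl
  have : IsScalarTower Ah Bh Ch := .of_algebraMap_eq fun _ => rfl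
  exact baseChange_baseChange (B := B) (Bh := Bh) hd hd' T

theorem map_id (f : A →+* A) (g : Ah →+* Ah) (hf : f = RingHom.id A) (hg : g = RingHom.id Ah)
    (hfg : g.comp (algebraMap A Ah) = (algebraMap A Ah).comp f)
    (hd : (d : A) ∈ nonZeroDivisors A) (T : LevelTriple A Ah n d) :
    Rel (T.map f g hfg hd) T := by
  subst hf hg
  exact baseChange_self' (RingHom.id A).toAlgebra (RingHom.id Ah).toAlgebra
    ((algebraMap A Ah).comp (RingHom.id A)).toAlgebra hd T
    (Algebra.algebra_ext _ _ fun _ => rfl) (Algebra.algebra_ext _ _ fun _ => rfl)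
    (Algebra.algebra_ext _ _ fun _ => rfl) (@IsScalarTower.of_algebraMap_eq' A A Ah _ _ _ (RingHom.id A).toAlgebra _
      ((algebraMap A Ah).comp (RingHom.id A)).toAlgebra rfl)
    (@IsScalarTower.of_algebraMap_eq' A Ah Ah _ _ _ _ (RingHom.id Ah).toAlgebra
      ((algebraMap A Ah).comp (RingHom.id A)).toAlgebra hfg.symm)

end
end LevelTriple

/-- `W_h(R)` as a `W(R)`-algebra through truncation. -/
noncomputable instance truncatedAlgebra (p : ℕ) [Fact p.Prime] (h : ℕ) (R : Type u) [CommRing R] :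
    Algebra (WittVector p R) (TruncatedWittVector p h R) :=
  (WittVector.truncate h).toAlgebra

/-- The ring map `W_h(R) → W_h(S)` induced by `f`, which applies `f` to each component. -/
noncomputable def truncMap (p : ℕ) [Fact p.Prime] (h : ℕ) {R S : Type u} [CommRing R] [CommRing S]
    (f : R →+* S) : TruncatedWittVector p h R →+* TruncatedWittVector p h S :=
  have key : ∀ X : WittVector p R,
      TruncatedWittVector.mk p (fun i => f ((WittVector.truncate h X).coeff i)) =
        WittVector.truncate h (WittVector.map f X) := fun X => by
    ext i; simp [WittVector.coeff_truncate]
  { toFun := fun x => TruncatedWittVector.mk p (fun i => f (x.coeff i))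
    map_one' := by rw [← map_one (WittVector.truncate h), key, map_one, map_one]
    map_zero' := by rw [← map_zero (WittVector.truncate h), key, map_zero, map_zero]
    map_mul' := fun x y => by
      obtain ⟨X, rfl⟩ := WittVector.truncate_surjective p h R x
      obtain ⟨Y, rfl⟩ := WittVector.truncate_surjective p h R y
      rw [← map_mul, key, key, key, map_mul, map_mul]
    map_add' := fun x y => by
      obtain ⟨X, rfl⟩ := WittVector.truncate_surjective p h R x
      obtain ⟨Y, rfl⟩ := WittVector.truncate_surjective p h R y
      rw [← map_add, key, key, key, map_add, map_add] }

section
variable (p : ℕ) [Fact p.Prime] (h : ℕ) {R S : Type u} [CommRing R] [CommRing S]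

@[simp] theorem truncMap_coeff (f : R →+* S) (x : TruncatedWittVector p h R) (i : Fin h) :
    (truncMap p h f x).coeff i = f (x.coeff i) :=
  TruncatedWittVector.coeff_mk _ _

theorem truncMap_truncate (f : R →+* S) (X : WittVector p R) :
    truncMap p h f (WittVector.truncate h X) = WittVector.truncate h (WittVector.map f X) := by
  ext i; simp [WittVector.coeff_truncate]

theorem truncMap_comp_algebraMap (f : R →+* S) :
    (truncMap p h f).comp (algebraMap (WittVector p R) (TruncatedWittVector p h R)) =
      (algebraMap (WittVector p S) (TruncatedWittVector p h S)).comp (WittVector.map f) :=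
  RingHom.ext fun X => truncMap_truncate p h f X

@[simp] theorem truncMap_id : truncMap p h (RingHom.id R) = RingHom.id _ := by
  ext x i; simp

theorem truncMap_comp {Q : Type u} [CommRing Q] (g : S →+* Q) (f : R →+* S) :
    truncMap p h (g.comp f) = (truncMap p h g).comp (truncMap p h f) := by
  ext x i; simp
end

/-- The category of perfect `k`-algebras. -/
abbrev PerfAlg (k : Type u) [CommRing k] (p : ℕ) : Type (u + 1) :=
  ObjectProperty.FullSubcategory (fun R : CommAlgCat.{u} k => PerfectRing R p)

theorem natCast_pow_mem_nonZeroDivisors (p : ℕ) [Fact p.Prime] (k : Type u) [Field k] [CharP k p]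
    (N : ℕ) (R : PerfAlg.{u} k p) :
    ((p ^ N : ℕ) : WittVector p R.obj) ∈ nonZeroDivisors (WittVector p R.obj) := by
  have := R.property
  rcases subsingleton_or_nontrivial R.obj with hR | hR
  · have : Subsingleton (WittVector p R.obj) :=
      ⟨fun x y => by ext i; exact Subsingleton.elim _ _⟩
    rw [mem_nonZeroDivisors_iff]
    exact ⟨fun _ _ => Subsingleton.elim _ _, fun _ _ => Subsingleton.elim _ _⟩
  · have : CharP R.obj p := charP_of_injective_algebraMap (algebraMap k R.obj).injective p
    rw [Nat.cast_pow]
    refine pow_mem ?_ N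
    rw [mem_nonZeroDivisors_iff_right]
    exact fun x hx => WittVector.eq_zero_of_p_mul_eq_zero x hx

section
variable (p : ℕ) [Fact p.Prime] (n N h : ℕ)

/-- The set of isomorphism classes of `(E, β, ε)` where `E` is a projective `W(R)`-module of rank `n`,
`β : E → W(R)ⁿ` satisfies `⋀ⁿβ : ⋀ⁿE ≃ p^N W(R)`, and `ε` trivializes `E` over `W_h(R)`. -/
abbrev GrPoints (R : Type u) [CommRing R] : Type (u + 1) :=
  Quotient (LevelTriple.setoid (WittVector p R) (TruncatedWittVector p h R) n (p ^ N))

variable {R S Q : Type u} [CommRing R] [CommRing S] [CommRing Q]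

/-- Base change along `f : R → S`. -/
noncomputable def GrPoints.map (f : R →+* S)
    (hS : ((p ^ N : ℕ) : WittVector p S) ∈ nonZeroDivisors (WittVector p S)) :
    GrPoints p n N h R → GrPoints p n N h S :=
  Quotient.map
    (LevelTriple.map (WittVector.map f) (truncMap p h f)
      (truncMap_comp_algebraMap p h _) hS)
    (fun _ _ => LevelTriple.Rel.map _ _ _ _)

theorem GrPoints.map_id
    (hR : ((p ^ N : ℕ) : WittVector p R) ∈ nonZeroDivisors (WittVector p R))
    (x : GrPoints p n N h R) : GrPoints.map p n N h (RingHom.id R) hR x = x := by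
  induction x using Quotient.inductionOn with
  | h T => exact Quotient.sound (LevelTriple.map_id _ _ (WittVector.map_id R) (truncMap_id p h)
      (truncMap_comp_algebraMap p h _) hR T)

theorem GrPoints.map_comp (f : R →+* S) (g : S →+* Q)
    (hS : ((p ^ N : ℕ) : WittVector p S) ∈ nonZeroDivisors (WittVector p S))
    (hQ : ((p ^ N : ℕ) : WittVector p Q) ∈ nonZeroDivisors (WittVector p Q))
    (x : GrPoints p n N h R) :
    GrPoints.map p n N h (g.comp f) hQ x =
      GrPoints.map p n N h g hQ (GrPoints.map p n N h f hS x) := by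
  induction x using Quotient.inductionOn with
  | h T =>
    refine Quotient.sound (LevelTriple.map_map (WittVector.map f) (truncMap p h f)
      (truncMap_comp_algebraMap p h _) hS (WittVector.map g) (truncMap p h g)
      (truncMap_comp_algebraMap p h _) hQ
      (WittVector.map (g.comp f)) (truncMap p h (g.comp f)) ?_ (truncMap_comp p h g f)
      (truncMap_comp_algebraMap p h _) T)
    ext X i
    simp [WittVector.map_coeff]

end

/-- The functor `R ↦ {(E, β, ε)} / ≅` on perfect `k`-algebras. -/
noncomputable def grFunctor (p : ℕ) [Fact p.Prime] (k : Type u) [Field k] [CharP k p]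
    (n N h : ℕ) : PerfAlg.{u} k p ⥤ Type (u + 1) where
  obj R := GrPoints p n N h R.obj
  map {R S} f := TypeCat.ofHom (GrPoints.map p n N h f.hom.hom.toRingHom
    (natCast_pow_mem_nonZeroDivisors p k N S))
  map_id R := by
    ext x
    exact GrPoints.map_id p n N h (natCast_pow_mem_nonZeroDivisors p k N R) x
  map_comp {R S Q} f g := by
    ext x
    exact GrPoints.map_comp p n N h f.hom.hom.toRingHom g.hom.hom.toRingHom
      (natCast_pow_mem_nonZeroDivisors p k N S) (natCast_pow_mem_nonZeroDivisors p k N Q) x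

/-- The matrices `A` over `W_h(R)` with `det₀ A = ⋯ = det_{N-1} A = 0` and `det_N A` invertible, where
`det A = (det₀ A, …, det_{h-1} A)` are the Witt components of the determinant. -/
def detLocus (p : ℕ) [Fact p.Prime] (n : ℕ) {N h : ℕ} (hN : N < h) (R : Type u) [CommRing R] :
    Set (Matrix (Fin n) (Fin n) (TruncatedWittVector p h R)) :=
  {A | (∀ i : Fin h, i.val < N → A.det.coeff i = 0) ∧ IsUnit (A.det.coeff ⟨N, hN⟩)}

theorem detLocus_map (p : ℕ) [Fact p.Prime] (n : ℕ) {N h : ℕ} (hN : N < h) {R S : Type u} [CommRing R]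
    [CommRing S] (f : R →+* S) {A : Matrix (Fin n) (Fin n) (TruncatedWittVector p h R)}
    (hA : A ∈ detLocus p n hN R) : A.map (truncMap p h f) ∈ detLocus p n hN S := by
  have hdet : (A.map (truncMap p h f)).det = truncMap p h f A.det :=
    (RingHom.map_det (truncMap p h f) A).symm
  refine ⟨fun i hi => ?_, ?_⟩
  · rw [hdet, truncMap_coeff, hA.1 i hi, map_zero]
  · rw [hdet, truncMap_coeff]
    exact hA.2.map f

section
variable (p : ℕ) [Fact p.Prime] (n : ℕ) {N h : ℕ} (hN : N < h)

/-- Pairs `(A, γ)` with `A` in the determinant locus, `γ ∈ GL_n(W_h(R))` and `A γ = A`. -/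
def StabPoints (R : Type u) [CommRing R] : Type u :=
  {x : Matrix (Fin n) (Fin n) (TruncatedWittVector p h R) ×
      Matrix.GeneralLinearGroup (Fin n) (TruncatedWittVector p h R) //
      x.1 ∈ detLocus p n hN R ∧ x.1 * x.2.val = x.1}

variable {R S Q : Type u} [CommRing R] [CommRing S] [CommRing Q]

/-- Functoriality of pairs `(A, γ)` in `R`. -/
noncomputable def StabPoints.map (f : R →+* S) (x : StabPoints p n hN R) : StabPoints p n hN S :=
  ⟨(x.1.1.map (truncMap p h f), Matrix.GeneralLinearGroup.map (truncMap p h f) x.1.2),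
    detLocus_map p n hN f x.2.1, by
      have := congrArg (fun M => M.map (truncMap p h f)) x.2.2
      rw [Matrix.map_mul] at this
      exact this⟩

theorem StabPoints.map_id (x : StabPoints p n hN R) :
    StabPoints.map p n hN (RingHom.id R) x = x := by
  refine Subtype.ext (Prod.ext ?_ (Units.ext ?_))
  · exact Matrix.ext fun i j => RingHom.congr_fun (truncMap_id (R := R) p h) _
  · exact Matrix.ext fun i j => RingHom.congr_fun (truncMap_id (R := R) p h) _

theorem StabPoints.map_comp (f : R →+* S) (g : S →+* Q) (x : StabPoints p n hN R) :
    StabPoints.map p n hN (g.comp f) x = StabPoints.map p n hN g (StabPoints.map p n hN f x) := by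
  refine Subtype.ext (Prod.ext ?_ (Units.ext ?_))
  · exact Matrix.ext fun i j => RingHom.congr_fun (truncMap_comp p h g f) _
  · exact Matrix.ext fun i j => RingHom.congr_fun (truncMap_comp p h g f) _
end

/-- The functor of points of the stabilizer scheme, on perfect `k`-algebras (a perfection and the
original scheme have the same points there). -/
noncomputable def stabFunctor (p : ℕ) [Fact p.Prime] (k : Type u) [Field k]
    (n : ℕ) {N h : ℕ} (hN : N < h) : PerfAlg.{u} k p ⥤ Type u where
  obj R := StabPoints p n hN R.obj
  map {R S} f := TypeCat.ofHom (StabPoints.map p n hN f.hom.hom.toRingHom)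
  map_id R := by
    ext x
    exact StabPoints.map_id p n hN x
  map_comp {R S Q} f g := by
    ext x
    exact StabPoints.map_comp p n hN f.hom.hom.toRingHom g.hom.hom.toRingHom x

/-- The map `(E, β, ε) ↦ β|_{W_h(R)} ∘ ε` to matrices over `W_h(R)`. -/
noncomputable def GrPoints.matrix (p : ℕ) [Fact p.Prime] (n N h : ℕ) {R : Type u} [CommRing R] :
    GrPoints p n N h R → Matrix (Fin n) (Fin n) (TruncatedWittVector p h R) :=
  Quotient.lift LevelTriple.matrix fun _ _ => LevelTriple.matrix_eq

/-- The perfect `k`-algebra `A` is the perfection of a `k`-algebra of finite type: some `i : B → A`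
has nilpotent kernel, and every `a : A` has some `a ^ p ^ m` in the image. As `A` is perfect, this
characterizes `A` as the perfection of `B`. -/
def IsPerfectlyFiniteType (k : Type u) [Field k] (p : ℕ) (A : PerfAlg.{u} k p) : Prop :=
  ∃ (B : CommAlgCat.{u} k) (i : B →ₐ[k] A.obj), Algebra.FiniteType k B ∧ IsPRadical i.toRingHom p

end LevelGr

/-! Write `A` for `W(R)` and `A_h` for `W_h(R)`. Since `R` is perfect, `p` is a nonzerodivisor in
the Jacobson radical of `A` and `A_h = A / p^h`; these facts (`IsTruncation`) are all that the
module theory uses. As `h > 0`, Nakayama lifts `ε` to a surjection `Aⁿ → E`, which is bijective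
because the ranks agree (`exists_lift_ε`). Hence every triple comes from a square matrix `B` over
`A` with `det B` equal to `p^N` up to a unit, and `B` reduces to the matrix of the triple over
`A_h`.

Let `M` be another lift of the same matrix, `B = M + p^h X`. Formally `M⁻¹B = 1 + p^h M⁻¹X`, and
`M⁻¹` has denominator only `p^N` with `N < h`. So `B = M g` with `g ≡ 1` modulo `p`, and `g` is
invertible (`exists_unit_mul_eq`). After fixing one lift `M` for each matrix over `A_h`, the triple
becomes `(Aⁿ, M, γ)` with `γ` the reduction of `g`, and `γ` stabilizes the reduction of `M`. This
`γ` is unique: `M` is injective, so `(Aⁿ, M)` has no automorphisms (`eq_of_rel_ofMatrix`). Extending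
Witt components by zero is a lift natural in `R`, so the bijection is an isomorphism of functors.

For representability, the Witt components of `A`, `γ`, `γ⁻¹` and the inverse of `det_N A` satisfy
polynomial equations in finitely many variables. The resulting algebra and its perfection have the
same points in perfect algebras. -/

namespace LevelGr

/-! ### Top exterior powers and determinants -/

section Wedge
variable {A : Type*} [CommRing A] {n : ℕ}

/-- Alternating maps are determined by injective families of basis vectors. Such families are
permutations of the basis, where both sides give the sign. -/
theorem ιMulti_eq_det_smul_topForm (v : Fin n → Fin n → A) :
    exteriorPower.ιMulti A n v = (Pi.basisFun A (Fin n)).det v • topForm A n := by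
  have : exteriorPower.ιMulti A n =
      ((LinearMap.toSpanSingleton A _ (topForm A n)).compAlternatingMap
        (Pi.basisFun A (Fin n)).det) := by
    refine Module.Basis.ext_alternating (Pi.basisFun A (Fin n)) fun i h => ?_
    let σ : Equiv.Perm (Fin n) := Equiv.ofBijective i (Finite.injective_iff_bijective.1 h)
    change exteriorPower.ιMulti A n (Pi.basisFun A (Fin n) ∘ σ) =
      LinearMap.toSpanSingleton A _ (topForm A n)
        ((Pi.basisFun A (Fin n)).det (Pi.basisFun A (Fin n) ∘ σ))
    rw [AlternatingMap.map_perm, AlternatingMap.map_perm, Module.Basis.det_self]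
    simp [topForm, -exteriorPower.ιMulti_apply_coe]
  exact congrArg (fun f => f v) this

theorem map_topForm (M : Matrix (Fin n) (Fin n) A) :
    exteriorPower.map n (Matrix.toLin' M) (topForm A n) = M.det • topForm A n := by
  rw [topForm, exteriorPower.map_apply_ιMulti, ιMulti_eq_det_smul_topForm]
  congr 1
  rw [Module.Basis.det_apply]
  congr 1
  ext i j
  simp [Module.Basis.toMatrix]

theorem exists_smul_topForm (x : ⋀[A]^n (Fin n → A)) : ∃ a : A, a • topForm A n = x :=
  Submodule.mem_span_singleton.1 (span_topForm (A := A) n ▸ Submodule.mem_top)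

theorem range_map_toLin' (M : Matrix (Fin n) (Fin n) A) :
    LinearMap.range (exteriorPower.map n (Matrix.toLin' M)) =
      Submodule.span A {M.det • topForm A n} := by
  rw [LinearMap.range_eq_map, ← span_topForm, Submodule.map_span, Set.image_singleton, map_topForm]

theorem ideal_smul_top_eq (d : A) :
    Ideal.span {d} • (⊤ : Submodule A (⋀[A]^n (Fin n → A))) =
      Submodule.span A {d • topForm A n} := by
  rw [← span_topForm, Submodule.ideal_span_singleton_smul, Submodule.smul_span,
    Set.smul_set_singleton]

/-- On the free rank one module `⋀ⁿAⁿ`, the map induced by `M` is multiplication by its determinant.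
-/
theorem wedgeIsoOnto_toLin' {M : Matrix (Fin n) (Fin n) A} {d : A} (hd : d ∈ nonZeroDivisors A)
    (h : Associated d M.det) : WedgeIsoOnto (Matrix.toLin' M) d := by
  obtain ⟨u, hu⟩ := h
  constructor
  · rw [injective_iff_map_eq_zero]
    intro x hx
    obtain ⟨a, rfl⟩ := exists_smul_topForm x
    rw [map_smul, map_topForm, smul_smul, ← hu] at hx
    have h0 := smul_topForm_eq_zero hx
    rw [mul_comm d, ← mul_assoc, mul_right_mem_nonZeroDivisors_eq_zero_iff hd,
      Units.mul_left_eq_zero] at h0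
    rw [h0, zero_smul]
  · rw [range_map_toLin', ideal_smul_top_eq, ← hu, mul_comm, ← smul_smul]
    exact Submodule.span_singleton_group_smul_eq A u _

theorem associated_det_of_wedgeIsoOnto {M : Matrix (Fin n) (Fin n) A} {d : A}
    (hd : d ∈ nonZeroDivisors A) (h : WedgeIsoOnto (Matrix.toLin' M) d) :
    Associated d M.det := by
  have hr := h.2
  rw [range_map_toLin', ideal_smul_top_eq] at hr
  obtain ⟨a, ha⟩ := Submodule.mem_span_singleton.1 (hr ▸ Submodule.mem_span_singleton_self _ :
    M.det • topForm A n ∈ Submodule.span A {d • topForm A n})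
  obtain ⟨b, hb⟩ := Submodule.mem_span_singleton.1 (hr ▸ Submodule.mem_span_singleton_self _ :
    d • topForm A n ∈ Submodule.span A {M.det • topForm A n})
  have inj : ∀ {x y : A}, x • topForm A n = y • topForm A n → x = y := fun {x y} e =>
    sub_eq_zero.1 (smul_topForm_eq_zero (n := n) ((sub_smul x y (topForm A n)).trans (sub_eq_zero.2 e)))
  rw [smul_smul] at ha hb
  have ha := inj ha
  have hb := inj hb
  -- Equality of the two spans only gives divisibility both ways; cancelling `d` turns the cofactors
  -- into mutually inverse units.
  have hab : (a * b - 1) * d = 0 := by linear_combination b * ha + hb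
  have hab := sub_eq_zero.1 ((mul_right_mem_nonZeroDivisors_eq_zero_iff hd).1 hab)
  exact ⟨⟨a, b, hab, by rw [mul_comm, hab]⟩, by rw [← ha, mul_comm]⟩

theorem WedgeIsoOnto.comp_equiv {E F : Type*} [AddCommGroup E] [Module A E] [AddCommGroup F]
    [Module A F] {β : E →ₗ[A] (Fin n → A)} {d : A} (h : WedgeIsoOnto β d) (φ : F ≃ₗ[A] E) :
    WedgeIsoOnto (β ∘ₗ φ.toLinearMap) d := by
  have h1 : exteriorPower.map n φ.symm.toLinearMap ∘ₗ exteriorPower.map n φ.toLinearMap =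
      LinearMap.id := by
    rw [← exteriorPower.map_comp]; simp
  have h2 : exteriorPower.map n φ.toLinearMap ∘ₗ exteriorPower.map n φ.symm.toLinearMap =
      LinearMap.id := by
    rw [← exteriorPower.map_comp]; simp
  have hinj : Function.Injective (exteriorPower.map n φ.toLinearMap) :=
    Function.LeftInverse.injective (g := exteriorPower.map n φ.symm.toLinearMap)
      (LinearMap.congr_fun h1)
  have hsurj : LinearMap.range (exteriorPower.map n φ.toLinearMap) = ⊤ :=
    LinearMap.range_eq_top.2 (Function.RightInverse.surjective
      (g := exteriorPower.map n φ.symm.toLinearMap) (LinearMap.congr_fun h2))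
  unfold WedgeIsoOnto
  rw [exteriorPower.map_comp]
  exact ⟨h.1.comp hinj, by rw [LinearMap.range_comp, hsurj, ← LinearMap.range_eq_map, h.2]⟩

end Wedge

/-! ### Matrices congruent modulo a high power -/

section Lift
variable {A : Type*} [CommRing A] {n : ℕ}

theorem isUnit_of_sub_mem_jacobson {x y : A} (hx : IsUnit x)
    (h : y - x ∈ Ideal.jacobson (⊥ : Ideal A)) : IsUnit y := by
  obtain ⟨u, rfl⟩ := hx
  have := Ideal.mem_jacobson_bot.1 h (↑u⁻¹ : A)
  have e : (y - u) * (↑u⁻¹ : A) + 1 = y * ↑u⁻¹ := by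
    rw [sub_mul, Units.mul_inv]; ring
  rw [e] at this
  exact (Units.isUnit_mul_units y u⁻¹).1 this

/-- Two matrices congruent modulo `q ^ h` differ by an invertible matrix, if one of them has
determinant `q ^ N` up to a unit and `N < h`. -/
theorem exists_unit_mul_eq {q : A} (hq : q ∈ Ideal.jacobson (⊥ : Ideal A)) {N h : ℕ} (hN : N < h)
    {M X : Matrix (Fin n) (Fin n) A} (hM : Associated (q ^ N) M.det) :
    ∃ g : (Matrix (Fin n) (Fin n) A)ˣ, M * g = M + q ^ h • X := by
  obtain ⟨u, hu⟩ := hM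
  -- Formally `q • Y = q ^ h • M⁻¹ * X`, since `M⁻¹` is the adjugate divided by `q ^ N * u`. The `-
  -- 1` in the exponent keeps one factor `q` outside, which `N < h` allows.
  let Y : Matrix (Fin n) (Fin n) A := ((↑u⁻¹ : A) * q ^ (h - N - 1)) • (M.adjugate * X)
  -- The matrix is the identity modulo `q`, so its determinant is `1` modulo the Jacobson radical.
  have hdet : IsUnit (1 + q • Y) := by
    rw [Matrix.isUnit_iff_isUnit_det]
    refine isUnit_of_sub_mem_jacobson isUnit_one (
      (Ideal.span_singleton_le_iff_mem _).2 hq ?_)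
    rw [← Ideal.Quotient.eq, map_one, RingHom.map_det]
    have : (Ideal.Quotient.mk (Ideal.span {q})).mapMatrix (1 + q • Y) = 1 := by
      rw [map_add, map_one, add_eq_left]
      ext i j
      simp [Ideal.Quotient.eq_zero_iff_mem.2 (Ideal.mem_span_singleton_self q)]
    rw [this, Matrix.det_one]
  refine ⟨hdet.unit, ?_⟩
  rw [IsUnit.unit_spec, mul_add, mul_one]
  congr 1
  simp only [Y, Matrix.mul_smul, ← Matrix.mul_assoc, Matrix.mul_adjugate, ← hu]
  rw [Matrix.smul_mul, Matrix.one_mul, smul_smul, smul_smul]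
  congr 1
  obtain ⟨m, rfl⟩ : ∃ m, h = N + m + 1 := ⟨h - N - 1, by omega⟩
  have : N + m + 1 - N - 1 = m := by omega
  rw [this]
  calc _ = q ^ (N + m + 1) * (u * ↑u⁻¹) := by ring
    _ = _ := by rw [Units.mul_inv, mul_one]

end Lift

/-- `A → Ah` is the quotient map by `q ^ h`, where `q` is a nonzerodivisor in the Jacobson radical. -/
structure IsTruncation (A Ah : Type*) [CommRing A] [CommRing Ah] [Algebra A Ah] (q h : ℕ) :
    Prop where
  surjective : Function.Surjective (algebraMap A Ah)
  ker : RingHom.ker (algebraMap A Ah) = Ideal.span {(q : A) ^ h}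
  mem_nonZeroDivisors : (q : A) ∈ nonZeroDivisors A
  mem_jacobson : (q : A) ∈ Ideal.jacobson (⊥ : Ideal A)

/-! ### Normal form of triples over a truncation -/

namespace LevelTriple

section
variable {A Ah : Type u} [CommRing A] [CommRing Ah] [Algebra A Ah] {n d : ℕ}

/-- The trivialization of the restriction of `Aⁿ` to `Ah` given by `γ`. -/
noncomputable def trivialization (A : Type u) [CommRing A] [Algebra A Ah]
    (γ : Matrix.GeneralLinearGroup (Fin n) Ah) : (Fin n → Ah) ≃ₗ[Ah] Ah ⊗[A] (Fin n → A) :=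
  (Matrix.toLin'OfInv γ.inv_mul γ.mul_inv).trans
    (TensorProduct.piScalarRight A Ah Ah (Fin n)).symm

theorem trivialization_apply (γ : Matrix.GeneralLinearGroup (Fin n) Ah) (v : Fin n → Ah) :
    trivialization A γ v =
      (TensorProduct.piScalarRight A Ah Ah (Fin n)).symm (γ.val.mulVec v) := by
  rfl

/-- The triple `(Aⁿ, M, γ)`. -/
noncomputable def ofMatrix (hd : (d : A) ∈ nonZeroDivisors A) (M : Matrix (Fin n) (Fin n) A)
    (hM : Associated (d : A) M.det) (γ : Matrix.GeneralLinearGroup (Fin n) Ah) :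
    LevelTriple A Ah n d where
  E := Fin n → A
  rank_eq q := by
    have := q.nontrivial
    rw [Module.rankAtStalk_eq_finrank_of_free]
    simp
  β := Matrix.toLin' M
  wedge := wedgeIsoOnto_toLin' hd hM
  ε := trivialization A γ

theorem coordBaseChange_toLin' (M : Matrix (Fin n) (Fin n) A) (v : Fin n → Ah) :
    coordBaseChange Ah (Matrix.toLin' M)
      ((TensorProduct.piScalarRight A Ah Ah (Fin n)).symm v) =
      (M.map (algebraMap A Ah)).mulVec v := by
  have : coordBaseChange Ah (Matrix.toLin' M) ∘ₗ
      (TensorProduct.piScalarRight A Ah Ah (Fin n)).symm.toLinearMap =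
      Matrix.toLin' (M.map (algebraMap A Ah)) := by
    apply LinearMap.pi_ext'
    intro i
    ext j
    simp [coordBaseChange, Algebra.smul_def, TensorProduct.piScalarRight_symm_single]
  exact LinearMap.congr_fun this v

theorem baseChange_toLin' (M : Matrix (Fin n) (Fin n) A) (v : Fin n → Ah) :
    (Matrix.toLin' M).baseChange Ah ((TensorProduct.piScalarRight A Ah Ah (Fin n)).symm v) =
      (TensorProduct.piScalarRight A Ah Ah (Fin n)).symm
        ((M.map (algebraMap A Ah)).mulVec v) := by
  rw [LinearEquiv.eq_symm_apply]
  exact coordBaseChange_toLin' M v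

theorem matrix_ofMatrix (hd : (d : A) ∈ nonZeroDivisors A) (M : Matrix (Fin n) (Fin n) A)
    (hM : Associated (d : A) M.det) (γ : Matrix.GeneralLinearGroup (Fin n) Ah) :
    (ofMatrix hd M hM γ).matrix = M.map (algebraMap A Ah) * γ.val := by
  unfold matrix
  rw [← LinearMap.toMatrix'_toLin' (M.map (algebraMap A Ah) * γ.val)]
  congr 1
  refine LinearMap.ext fun v => ?_
  rw [LinearMap.comp_apply]
  change coordBaseChange Ah (Matrix.toLin' M) (trivialization A γ v) = _
  rw [trivialization_apply, coordBaseChange_toLin', Matrix.toLin'_apply, Matrix.mulVec_mulVec]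

/-- Rigidity: an isomorphism `φ` satisfies `M φ = M`, and `M` is injective because its determinant
is a nonzerodivisor. So `φ` is the identity and the trivializations coincide. -/
theorem eq_of_rel_ofMatrix (hd : (d : A) ∈ nonZeroDivisors A) {M : Matrix (Fin n) (Fin n) A}
    (hM : Associated (d : A) M.det) {γ γ' : Matrix.GeneralLinearGroup (Fin n) Ah}
    (h : Rel (ofMatrix hd M hM γ) (ofMatrix hd M hM γ')) : γ = γ' := by
  obtain ⟨φ, h1, h2⟩ := h
  have hdet : M.det ∈ nonZeroDivisors A := by
    obtain ⟨u, hu⟩ := hM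
    rw [← hu]
    exact mul_mem hd u.isUnit.mem_nonZeroDivisors
  have hφ : φ = LinearEquiv.refl A (Fin n → A) := by
    apply LinearEquiv.ext
    intro x
    exact Matrix.mulVec_injective_of_det_mem_nonZeroDivisors hdet (h1 x)
  have h3 : ∀ v, trivialization A γ v = trivialization A γ' v := by
    intro v
    refine Eq.trans ?_ (h2 v)
    rw [hφ]
    change _ = (LinearMap.id : (Fin n → A) →ₗ[A] (Fin n → A)).baseChange Ah (trivialization A γ v)
    simp
  apply Units.ext
  apply Matrix.toLin'.injective
  refine LinearMap.ext fun v => ?_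
  have := h3 v
  rwa [trivialization_apply, trivialization_apply,
    (TensorProduct.piScalarRight A Ah Ah (Fin n)).symm.injective.eq_iff] at this

/-- With `I` the kernel, `Ah` is `A ⧸ I`, and the kernel of `E → (A ⧸ I) ⊗ E` is `I • E`. -/
theorem mem_ker_smul_top_of_one_tmul_eq_zero (hs : Function.Surjective (algebraMap A Ah))
    {E : Type*} [AddCommGroup E] [Module A E] {x : E} (hx : (1 : Ah) ⊗ₜ[A] x = 0) :
    x ∈ RingHom.ker (algebraMap A Ah) • (⊤ : Submodule A E) := by
  let e : (A ⧸ RingHom.ker (Algebra.ofId A Ah)) ≃ₐ[A] Ah :=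
    Ideal.quotientKerAlgEquivOfSurjective hs
  have := congrArg (LinearMap.rTensor E e.symm.toLinearMap) hx
  rw [LinearMap.rTensor_tmul, map_zero] at this
  have h1 : e.symm.toLinearMap (1 : Ah) = 1 := map_one e.symm
  rw [h1] at this
  have hk := LinearMap.ker_tensorProductMk (I := RingHom.ker (Algebra.ofId A Ah)) (Q := E)
  have hm : x ∈ LinearMap.ker (TensorProduct.mk A (A ⧸ RingHom.ker (Algebra.ofId A Ah)) E 1) := this
  rw [hk] at hm
  exact hm

/-- A trivialization over a truncation lifts. -/
theorem exists_lift_ε {q h : ℕ} (ht : IsTruncation A Ah q h) (hh : h ≠ 0)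
    (T : LevelTriple A Ah n d) : ∃ φ : (Fin n → A) ≃ₗ[A] T.E, ∀ v,
      φ.toLinearMap.baseChange Ah ((TensorProduct.piScalarRight A Ah Ah (Fin n)).symm v) =
        T.ε v := by
  -- Since `A → Ah` is surjective, so is `E → Ah ⊗ E`; the images of the standard basis lift to `E`.
  choose e he using fun i => TensorProduct.mk_surjective A T.E Ah ht.surjective
    (T.ε (Pi.single i 1))
  let φ : (Fin n → A) →ₗ[A] T.E := Fintype.linearCombination A e
  have hφ : ∀ v, φ.baseChange Ah ((TensorProduct.piScalarRight A Ah Ah (Fin n)).symm v) =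
      T.ε v := by
    intro v
    have : φ.baseChange Ah ∘ₗ (TensorProduct.piScalarRight A Ah Ah (Fin n)).symm.toLinearMap =
        T.ε.toLinearMap := by
      apply LinearMap.pi_ext'
      intro i
      ext
      simpa [φ, TensorProduct.piScalarRight_symm_single] using he i
    exact LinearMap.congr_fun this v
  have hsurj : Function.Surjective φ := by
    rw [← LinearMap.range_eq_top, eq_top_iff]
    -- Nakayama. The kernel is generated by `q ^ h`, which lies in the Jacobson radical because `h ≠
    -- 0`.
    refine Submodule.le_of_le_smul_of_le_jacobson_bot (I := RingHom.ker (algebraMap A Ah))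
      Module.Finite.fg_top ?_ ?_
    · rw [ht.ker, Ideal.span_singleton_le_iff_mem]
      exact Ideal.pow_mem_of_mem _ ht.mem_jacobson _ (Nat.pos_of_ne_zero hh)
    · intro x _
      choose c hc using fun i => ht.surjective (T.ε.symm (1 ⊗ₜ x) i)
      have : (1 : Ah) ⊗ₜ[A] (x - φ c) = 0 := by
        rw [TensorProduct.tmul_sub, sub_eq_zero, ← LinearMap.baseChange_tmul]
        have h1 : (1 : Ah) ⊗ₜ[A] c =
            (TensorProduct.piScalarRight A Ah Ah (Fin n)).symm (T.ε.symm (1 ⊗ₜ x)) := by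
          rw [LinearEquiv.eq_symm_apply]
          ext i
          simp [← hc, Algebra.smul_def]
        rw [h1, hφ, LinearEquiv.apply_symm_apply]
      rw [← sub_add_cancel x (φ c), add_comm]
      exact Submodule.add_mem_sup ⟨c, rfl⟩ (mem_ker_smul_top_of_one_tmul_eq_zero ht.surjective this)
  have hbij : Function.Bijective φ := by
    -- A surjection between finite projective modules of the same rank is bijective.
    refine Module.bijective_of_surjective_of_rankAtStalk_eq hsurj fun m _ => ?_
    have : Nontrivial A := (PrimeSpectrum.mk m inferInstance).nontrivial
    rw [T.rank_eq, Module.rankAtStalk_eq_finrank_of_free]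
    simp
  exact ⟨LinearEquiv.ofBijective φ hbij, hφ⟩

/-- In the frame `φ` lifting `ε`, the map `β` becomes a square matrix. The wedge condition fixes its
determinant up to a unit, and its reduction is `T.matrix` because `φ` reduces to `ε`. -/
theorem exists_associated_det {q h : ℕ} (ht : IsTruncation A Ah q h) (hh : h ≠ 0)
    (hd : (d : A) ∈ nonZeroDivisors A) (T : LevelTriple A Ah n d) :
    ∃ (φ : (Fin n → A) ≃ₗ[A] T.E) (M : Matrix (Fin n) (Fin n) A),
      (∀ v, φ.toLinearMap.baseChange Ah ((TensorProduct.piScalarRight A Ah Ah (Fin n)).symm v) =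
        T.ε v) ∧ Matrix.toLin' M = T.β ∘ₗ φ.toLinearMap ∧ Associated (d : A) M.det ∧
      M.map (algebraMap A Ah) = T.matrix := by
  obtain ⟨φ, hφ⟩ := exists_lift_ε ht hh T
  have hM := Matrix.toLin'_toMatrix' (T.β ∘ₗ φ.toLinearMap)
  refine ⟨φ, LinearMap.toMatrix' (T.β ∘ₗ φ.toLinearMap), hφ, hM, ?_, ?_⟩
  · apply associated_det_of_wedgeIsoOnto hd
    rw [hM]
    exact T.wedge.comp_equiv φ
  · apply Matrix.toLin'.injective
    rw [LevelTriple.matrix, Matrix.toLin'_toMatrix']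
    refine LinearMap.ext fun v => ?_
    rw [Matrix.toLin'_apply, ← coordBaseChange_toLin', hM, LinearMap.comp_apply,
      LinearEquiv.coe_coe, ← hφ, coordBaseChange, coordBaseChange, LinearMap.baseChange_comp]
    rfl

/-- Allows the lift `M` to be prescribed. The matrix `B` of `T` in a lifted frame is `M * g`;
changing the frame by `g` replaces `B` by `M` and the standard trivialization by the reduction `γ`
of `g`. As `M` and `B` have the same reduction, `γ` stabilizes it. -/
theorem exists_rel_ofMatrix {q N h : ℕ} (ht : IsTruncation A Ah q h) (hN : N < h)
    (hd : ((q ^ N : ℕ) : A) ∈ nonZeroDivisors A) (T : LevelTriple A Ah n (q ^ N))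
    {M : Matrix (Fin n) (Fin n) A} (hM : Associated ((q ^ N : ℕ) : A) M.det)
    (hMT : M.map (algebraMap A Ah) = T.matrix) :
    ∃ γ : Matrix.GeneralLinearGroup (Fin n) Ah, T.matrix * γ.val = T.matrix ∧
      Rel (ofMatrix hd M hM γ) T := by
  obtain ⟨φ, B, hφ, hB, -, hBT⟩ := exists_associated_det ht (by omega) hd T
  have hmem : ∀ i j, ∃ x, B i j - M i j = (q : A) ^ h * x := by
    intro i j
    have : B i j - M i j ∈ RingHom.ker (algebraMap A Ah) := by
      rw [RingHom.mem_ker, map_sub, sub_eq_zero]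
      exact congrFun (congrFun (hBT.trans hMT.symm) i) j
    rw [ht.ker, Ideal.mem_span_singleton] at this
    exact this
  choose X hX using hmem
  obtain ⟨g, hg⟩ := exists_unit_mul_eq ht.mem_jacobson hN (X := Matrix.of X)
    (by rwa [Nat.cast_pow] at hM)
  have hgB : M * g = B := by
    rw [hg]
    ext i j
    simp [← hX]
  let γ : Matrix.GeneralLinearGroup (Fin n) Ah :=
    Matrix.GeneralLinearGroup.map (algebraMap A Ah) g
  refine ⟨γ, ?_, ?_⟩
  · rw [← hMT]
    change M.map (algebraMap A Ah) * g.val.map (algebraMap A Ah) = _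
    rw [← Matrix.map_mul, hgB, hBT, hMT]
  · refine (LevelTriple.setoid A Ah n (q ^ N)).symm ⟨φ.symm.trans
      (Matrix.toLin'OfInv g.inv_mul g.mul_inv), fun x => ?_, fun v => ?_⟩
    · obtain ⟨y, rfl⟩ := φ.surjective x
      have := LinearMap.congr_fun hB y
      rw [LinearMap.comp_apply, LinearEquiv.coe_coe, ← hgB] at this
      rw [← this]
      change Matrix.toLin' M (Matrix.toLin' g.val (φ.symm (φ y))) = _
      rw [φ.symm_apply_apply, Matrix.toLin'_mul, LinearMap.comp_apply]
    · change ((Matrix.toLin' g.val) ∘ₗ φ.symm.toLinearMap).baseChange Ah (T.ε v) =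
        trivialization A γ v
      rw [← hφ, ← LinearMap.comp_apply, ← LinearMap.baseChange_comp, LinearMap.comp_assoc]
      simp only [LinearEquiv.symm_comp, LinearMap.comp_id]
      rw [baseChange_toLin', trivialization_apply]
      rfl

end

/-! ### Base change of the normal form -/

section
variable {A Ah B Bh : Type u} [CommRing A] [CommRing Ah] [CommRing B] [CommRing Bh]
  [Algebra A Ah] [Algebra B Bh] [Algebra A B] [Algebra Ah Bh] [Algebra A Bh]
  [IsScalarTower A B Bh] [IsScalarTower A Ah Bh] {n d : ℕ}

theorem piScalarRight_baseChange_compare (v : Fin n → Ah) :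
    (TensorProduct.piScalarRight A B B (Fin n)).toLinearMap.baseChange Bh
      (compare A Ah B Bh (Fin n → A)
        (1 ⊗ₜ (TensorProduct.piScalarRight A Ah Ah (Fin n)).symm v)) =
      (TensorProduct.piScalarRight B Bh Bh (Fin n)).symm (fun i => algebraMap Ah Bh (v i)) := by
  -- Writing `v` as the image of a tensor reduces the claim to pure tensors.
  obtain ⟨z, rfl⟩ := (TensorProduct.piScalarRight A Ah Ah (Fin n)).surjective v
  rw [LinearEquiv.symm_apply_apply, LinearEquiv.eq_symm_apply]
  induction z using TensorProduct.induction_on with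
  | zero =>
    rw [TensorProduct.tmul_zero, LinearEquiv.map_zero, LinearMap.map_zero, LinearEquiv.map_zero]
    ext i
    simp
  | tmul a x =>
    ext i
    simp [compare_one_tmul, Algebra.smul_def, ← IsScalarTower.algebraMap_apply]
  | add x y hx hy =>
    rw [TensorProduct.tmul_add, LinearEquiv.map_add, LinearMap.map_add, LinearEquiv.map_add, hx, hy]
    ext i
    simp

theorem rel_baseChange_ofMatrix (hdA : (d : A) ∈ nonZeroDivisors A)
    (hdB : (d : B) ∈ nonZeroDivisors B) {M : Matrix (Fin n) (Fin n) A}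
    (hM : Associated (d : A) M.det) (γ : Matrix.GeneralLinearGroup (Fin n) Ah)
    (hM' : Associated (d : B) (M.map (algebraMap A B)).det) :
    Rel ((ofMatrix hdA M hM γ).baseChange B Bh hdB)
      (ofMatrix hdB (M.map (algebraMap A B)) hM'
        (Matrix.GeneralLinearGroup.map (algebraMap Ah Bh) γ)) := by
  refine Rel.of_single (TensorProduct.piScalarRight A B B (Fin n)) (fun x => ?_) (fun i => ?_)
  · obtain ⟨v, rfl⟩ := (TensorProduct.piScalarRight A B B (Fin n)).symm.surjective x
    refine Eq.trans ?_ (coordBaseChange_toLin' M v).symm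
    exact congrArg (Matrix.toLin' (M.map (algebraMap A B)))
      ((TensorProduct.piScalarRight A B B (Fin n)).apply_symm_apply v)
  · rw [baseChange_ε_single]
    change (TensorProduct.piScalarRight A B B (Fin n)).toLinearMap.baseChange Bh
      (compare A Ah B Bh (Fin n → A) (1 ⊗ₜ trivialization A γ _)) = trivialization B _ _
    rw [trivialization_apply, trivialization_apply, piScalarRight_baseChange_compare]
    congr 1
    ext j
    simp

end

section
variable {A Ah B Bh : Type u} [CommRing A] [CommRing Ah] [CommRing B] [CommRing Bh]
  [Algebra A Ah] [Algebra B Bh] {n d : ℕ}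

/-- `M'` is a separate variable so that a lift chosen over `B` can stand for the image of the lift
over `A`. -/
theorem rel_map_ofMatrix (f : A →+* B) (g : Ah →+* Bh)
    (hfg : g.comp (algebraMap A Ah) = (algebraMap B Bh).comp f)
    (hdA : (d : A) ∈ nonZeroDivisors A)
    (hdB : (d : B) ∈ nonZeroDivisors B) {M : Matrix (Fin n) (Fin n) A}
    (hM : Associated (d : A) M.det) (γ : Matrix.GeneralLinearGroup (Fin n) Ah)
    {M' : Matrix (Fin n) (Fin n) B} (hMM' : M.map f = M')
    (hM' : Associated (d : B) M'.det) :
    Rel ((ofMatrix hdA M hM γ).map f g hfg hdB)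
      (ofMatrix hdB M' hM' (Matrix.GeneralLinearGroup.map g γ)) := by
  subst hMM'
  let _ := f.toAlgebra
  let _ := g.toAlgebra
  let _ := ((algebraMap B Bh).comp f).toAlgebra
  have : IsScalarTower A B Bh := .of_algebraMap_eq fun _ => rfl
  have : IsScalarTower A Ah Bh := .of_algebraMap_eq fun x => (RingHom.congr_fun hfg x).symm
  exact rel_baseChange_ofMatrix hdA hdB hM γ hM'

end
end LevelTriple

/-! ### Witt vectors of perfect algebras and the isomorphism of functors -/

section Witt

/-- The zero ring is a perfect `k`-algebra but not of characteristic `p`, so it is split off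
wherever `CharP R p` is needed. -/
theorem charP_or_subsingleton {p : ℕ} (k : Type u) [Field k] [CharP k p] (R : Type u) [CommRing R]
    [Algebra k R] : CharP R p ∨ Subsingleton R := by
  rcases subsingleton_or_nontrivial R with hR | hR
  · exact .inr hR
  · exact .inl (charP_of_injective_algebraMap (algebraMap k R).injective p)

theorem subsingleton_witt {p : ℕ} (R : Type*) [Subsingleton R] : Subsingleton (WittVector p R) :=
  ⟨fun _ _ => WittVector.ext fun _ => Subsingleton.elim _ _⟩

theorem subsingleton_truncatedWitt {p : ℕ} (h : ℕ) (R : Type*) [Subsingleton R] :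
    Subsingleton (TruncatedWittVector p h R) :=
  ⟨fun _ _ => TruncatedWittVector.ext fun _ => Subsingleton.elim _ _⟩

variable {p : ℕ} [Fact p.Prime]

/-- For perfect `R` the kernel of the zeroth component is generated by `p`, and `W(R)` is
`p`-adically complete, so this kernel lies in the Jacobson radical. -/
theorem isUnit_witt_of_coeff_zero {R : Type*} [CommRing R] [CharP R p] [PerfectRing R p]
    {x : WittVector p R} (hx : IsUnit (x.coeff 0)) : IsUnit x := by
  obtain ⟨y, hy⟩ := WittVector.constantCoeff_surjective (R := R) p (↑hx.unit⁻¹ : R)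
  have h1 : x * y - 1 ∈ Ideal.span {(p : WittVector p R)} := by
    rw [← WittVector.ker_constantCoeff, RingHom.mem_ker, map_sub, map_mul, map_one, hy, sub_eq_zero]
    exact hx.mul_val_inv
  exact isUnit_of_mul_isUnit_left
    (isUnit_of_sub_mem_jacobson isUnit_one (IsAdicComplete.le_jacobson_bot _ h1))

/-- Multiplication by `p ^ N` shifts the components by `N` and raises them to the power `p ^ N`.
Over a perfect ring, `N` leading zeros mean divisibility by `p ^ N`, and the quotient is a unit
exactly when its zeroth component is. -/
theorem associated_p_pow_iff {R : Type*} [CommRing R] [CharP R p] [PerfectRing R p]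
    (N : ℕ) (x : WittVector p R) :
    Associated ((p ^ N : ℕ) : WittVector p R) x ↔
      (∀ i < N, x.coeff i = 0) ∧ IsUnit (x.coeff N) := by
  have hcoeff (y : WittVector p R) : (y * (p : WittVector p R) ^ N).coeff N = y.coeff 0 ^ p ^ N := by
    simpa using WittVector.mul_pow_charP_coeff_succ y (m := 0) (n := N)
  rw [Nat.cast_pow]
  constructor
  · rintro ⟨u, rfl⟩
    rw [mul_comm]
    refine ⟨fun i hi => WittVector.mul_pow_charP_coeff_zero _ hi, ?_⟩
    rw [hcoeff]
    exact (u.isUnit.map (WittVector.constantCoeff (p := p) (R := R))).pow _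
  · rintro ⟨h0, hN⟩
    obtain ⟨y, rfl⟩ := Ideal.mem_span_singleton.1
      ((WittVector.mem_span_p_pow_iff_le_coeff_eq_zero x N).2 h0)
    rw [mul_comm, hcoeff] at hN
    have hy : IsUnit y := isUnit_witt_of_coeff_zero
      ((isUnit_pow_iff (pow_ne_zero _ (Fact.out : p.Prime).ne_zero)).1 hN)
    exact ⟨hy.unit, rfl⟩

theorem isTruncation_witt (h : ℕ) {R : Type u} [CommRing R] [CharP R p] [PerfectRing R p] :
    IsTruncation (WittVector p R) (TruncatedWittVector p h R) p h where
  surjective := WittVector.truncate_surjective p h R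
  ker := by
    ext x
    rw [WittVector.mem_span_p_pow_iff_le_coeff_eq_zero]
    exact WittVector.mem_ker_truncate h x
  mem_nonZeroDivisors := by
    rw [mem_nonZeroDivisors_iff_right]
    exact WittVector.eq_zero_of_p_mul_eq_zero
  mem_jacobson := IsAdicComplete.le_jacobson_bot _ (Ideal.mem_span_singleton_self _)

variable {k : Type u} [Field k] [CharP k p]

theorem PerfAlg.isTruncation (h : ℕ) (R : PerfAlg.{u} k p) :
    IsTruncation (WittVector p R.obj) (TruncatedWittVector p h R.obj) p h := by
  have := R.property
  rcases charP_or_subsingleton (p := p) k R.obj with hR | hR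
  · exact isTruncation_witt h
  · have := subsingleton_witt (p := p) R.obj
    have := subsingleton_truncatedWitt (p := p) h R.obj
    exact ⟨fun x => ⟨0, Subsingleton.elim _ _⟩, Subsingleton.elim _ _,
      mem_nonZeroDivisors_iff_right.2 fun _ _ => Subsingleton.elim _ _,
      by rw [Subsingleton.elim (p : WittVector p R.obj) 0]; exact zero_mem _⟩

theorem PerfAlg.associated_p_pow_iff (N : ℕ) (R : PerfAlg.{u} k p) (x : WittVector p R.obj) :
    Associated ((p ^ N : ℕ) : WittVector p R.obj) x ↔
      (∀ i < N, x.coeff i = 0) ∧ IsUnit (x.coeff N) := by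
  have := R.property
  rcases charP_or_subsingleton (p := p) k R.obj with hR | hR
  · exact LevelGr.associated_p_pow_iff N x
  · have := subsingleton_witt (p := p) R.obj
    exact ⟨fun _ => ⟨fun _ _ => Subsingleton.elim _ _, isUnit_of_subsingleton _⟩,
      fun _ => ⟨1, Subsingleton.elim _ _⟩⟩

variable {n N h : ℕ} (hN : N < h)

/-- Since `N < h`, the components that decide whether the determinant is `p ^ N` up to a unit
survive truncation. -/
theorem PerfAlg.mem_detLocus_iff (R : PerfAlg.{u} k p)
    (M : Matrix (Fin n) (Fin n) (WittVector p R.obj)) :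
    M.map (algebraMap _ (TruncatedWittVector p h R.obj)) ∈ detLocus p n hN R.obj ↔
      Associated ((p ^ N : ℕ) : WittVector p R.obj) M.det := by
  have hdet : (M.map (algebraMap _ (TruncatedWittVector p h R.obj))).det =
      WittVector.truncate h M.det := (RingHom.map_det _ M).symm
  rw [PerfAlg.associated_p_pow_iff]
  simp only [detLocus, Set.mem_ofPred_eq, hdet, WittVector.coeff_truncate]
  exact ⟨fun H => ⟨fun i hi => H.1 ⟨i, hi.trans hN⟩ hi, H.2⟩, fun H => ⟨fun i hi => H.1 i hi, H.2⟩⟩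

/-- The lift of a matrix over `W_h(R)` to `W(R)` that extends Witt components by zero. -/
noncomputable def liftMatrix {R : Type*} [CommRing R]
    (M : Matrix (Fin n) (Fin n) (TruncatedWittVector p h R)) :
    Matrix (Fin n) (Fin n) (WittVector p R) :=
  M.map TruncatedWittVector.out

theorem map_liftMatrix {R : Type u} [CommRing R]
    (M : Matrix (Fin n) (Fin n) (TruncatedWittVector p h R)) :
    (liftMatrix M).map (algebraMap _ (TruncatedWittVector p h R)) = M := by
  ext i j
  exact congrArg (fun x => TruncatedWittVector.coeff _ x)
    (TruncatedWittVector.truncateFun_out (M i j))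

/-- The lift is not a ring homomorphism, but Witt functoriality acts componentwise and fixes zero.
This is what makes the comparison natural in `R`. -/
theorem liftMatrix_map {R S : Type u} [CommRing R] [CommRing S] (f : R →+* S)
    (M : Matrix (Fin n) (Fin n) (TruncatedWittVector p h R)) :
    (liftMatrix M).map (WittVector.map f) = liftMatrix (M.map (truncMap p h f)) := by
  ext i j l
  by_cases hl : l < h <;> simp [liftMatrix, TruncatedWittVector.out, WittVector.map_coeff, hl]

theorem associated_det_liftMatrix (R : PerfAlg.{u} k p) (x : StabPoints p n hN R.obj) :
    Associated ((p ^ N : ℕ) : WittVector p R.obj) (liftMatrix x.1.1).det := by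
  rw [← PerfAlg.mem_detLocus_iff hN, map_liftMatrix]
  exact x.2.1

/-- `(A, γ) ↦ (W(R)ⁿ, Ã, γ)`, where `Ã` extends the Witt components of `A` by zero. -/
noncomputable def stabToGr (R : PerfAlg.{u} k p) (x : StabPoints p n hN R.obj) :
    GrPoints p n N h R.obj :=
  ⟦LevelTriple.ofMatrix (natCast_pow_mem_nonZeroDivisors p k N R) (liftMatrix x.1.1)
    (associated_det_liftMatrix hN R x) x.1.2⟧

theorem matrix_stabToGr (R : PerfAlg.{u} k p) (x : StabPoints p n hN R.obj) :
    GrPoints.matrix p n N h (stabToGr hN R x) = x.1.1 := by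
  refine (LevelTriple.matrix_ofMatrix _ _ _ _).trans ?_
  rw [map_liftMatrix]
  exact x.2.2

/-- Injectivity: the matrix of the triple recovers `A`, and rigidity then recovers `γ`.
Surjectivity: the normal form is applied with the zero-extended lift of `T.matrix` as prescribed
lift. -/
theorem stabToGr_bijective (R : PerfAlg.{u} k p) :
    Function.Bijective (stabToGr (n := n) hN R) := by
  constructor
  · rintro ⟨⟨M, γ⟩, hx⟩ ⟨⟨M', γ'⟩, hx'⟩ e
    have hM : M = M' :=
      (matrix_stabToGr hN R _).symm.trans
        ((congrArg (GrPoints.matrix p n N h) e).trans (matrix_stabToGr hN R _))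
    subst hM
    have := LevelTriple.eq_of_rel_ofMatrix _ _ (Quotient.exact e)
    exact Subtype.ext (Prod.ext rfl this)
  · intro y
    induction y using Quotient.inductionOn with
    | h T =>
      have hd := natCast_pow_mem_nonZeroDivisors p k N R
      have ht := PerfAlg.isTruncation h R
      obtain ⟨_, B, _, _, hB, hBT⟩ := LevelTriple.exists_associated_det ht (by omega) hd T
      have hT : T.matrix ∈ detLocus p n hN R.obj := by
        rw [← hBT, PerfAlg.mem_detLocus_iff]
        exact hB
      have hM : Associated ((p ^ N : ℕ) : WittVector p R.obj) (liftMatrix T.matrix).det := by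
        rw [← PerfAlg.mem_detLocus_iff hN, map_liftMatrix]
        exact hT
      obtain ⟨γ, hγ, hrel⟩ := LevelTriple.exists_rel_ofMatrix ht hN hd T hM (map_liftMatrix _)
      exact ⟨⟨(T.matrix, γ), hT, hγ⟩, Quotient.sound hrel⟩

theorem stabToGr_map {R S : PerfAlg.{u} k p} (f : R ⟶ S) (x : StabPoints p n hN R.obj) :
    stabToGr hN S (StabPoints.map p n hN f.hom.hom.toRingHom x) =
      GrPoints.map p n N h f.hom.hom.toRingHom (natCast_pow_mem_nonZeroDivisors p k N S)
        (stabToGr hN R x) :=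
  (Quotient.sound (LevelTriple.rel_map_ofMatrix _ _ _ _ _ _ _ (liftMatrix_map _ _) _)).symm

/-- The isomorphism between the stabilizer scheme and the triples `(E, β, ε)`. -/
noncomputable def stabIsoGr (p : ℕ) [Fact p.Prime] (k : Type u) [Field k] [CharP k p] (n : ℕ)
    {N h : ℕ} (hN : N < h) :
    stabFunctor p k n hN ⋙ uliftFunctor.{u + 1, u} ≅ grFunctor p k n N h :=
  NatIso.ofComponents
    (fun R => (Equiv.ulift.trans (Equiv.ofBijective _ (stabToGr_bijective hN R))).toIso)
    (fun f => by
      ext x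
      exact stabToGr_map hN f x.down)

theorem matrix_stabIsoGr (R : PerfAlg.{u} k p) (x : StabPoints p n hN R.obj) :
    GrPoints.matrix p n N h ((stabIsoGr p k n hN).hom.app R (ULift.up x)) = x.1.1 :=
  matrix_stabToGr hN R x

end Witt

/-! ### Perfection of a `k`-algebra -/

section Perfection
variable (p : ℕ) [Fact p.Prime] (k : Type u) [Field k] [CharP k p]

/-- Every `k`-algebra has a perfection. -/
theorem exists_perfection (B : Type u) [CommRing B] [Algebra k B] :
    ∃ (A : PerfAlg.{u} k p) (i : B →ₐ[k] A.obj), IsPRadical i.toRingHom p ∧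
      ∀ (R : PerfAlg.{u} k p) (f : B →ₐ[k] R.obj), ∃! g : A.obj →ₐ[k] R.obj, g.comp i = f := by
  rcases charP_or_subsingleton (p := p) k B with hB | hB
  · let _ : Algebra k (PerfectClosure B p) :=
      ((PerfectClosure.of B p).comp (algebraMap k B)).toAlgebra
    let i : B →ₐ[k] PerfectClosure B p := ⟨PerfectClosure.of B p, fun _ => rfl⟩
    refine ⟨⟨CommAlgCat.of k (PerfectClosure B p), PerfectClosure.instPerfectRing B p⟩, i,
      PerfectClosure.isPRadical B p, fun R f => ?_⟩
    have := R.property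
    rcases charP_or_subsingleton (p := p) k R.obj with hR | hR
    · have hof : ∀ x, PerfectClosure.lift B p R.obj f.toRingHom (PerfectClosure.of B p x) = f x :=
        fun x => RingHom.congr_fun
          ((PerfectClosure.lift B p R.obj).symm_apply_apply f.toRingHom) x
      refine ⟨⟨PerfectClosure.lift B p R.obj f.toRingHom, fun c => ?_⟩, ?_, fun g hg => ?_⟩
      -- The scalars act through `B`, so the lifted ring map is `k`-linear because `f` is.
      · exact (hof _).trans (f.commutes c)
      · ext x
        exact hof x
      · apply AlgHom.coe_ringHom_injective
        apply (PerfectClosure.lift B p R.obj).symm.injective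
        refine RingHom.ext fun x => ?_
        exact (AlgHom.congr_fun hg x).trans (hof x).symm
    · exact ⟨⟨⟨⟨⟨fun _ => 0, Subsingleton.elim _ _⟩, fun _ _ => Subsingleton.elim _ _⟩,
        Subsingleton.elim _ _, fun _ _ => Subsingleton.elim _ _⟩, fun _ => Subsingleton.elim _ _⟩,
        AlgHom.ext fun _ => Subsingleton.elim _ _,
        fun g _ => AlgHom.ext fun _ => Subsingleton.elim _ _⟩
  -- The zero ring is its own perfection.
  · refine ⟨⟨CommAlgCat.of k B, ⟨?_⟩⟩, AlgHom.id k B, IsPRadical.of_id B p,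
      fun R f => ⟨f, AlgHom.comp_id f, fun g hg => hg⟩⟩
    exact ⟨fun _ _ _ => Subsingleton.elim (α := B) _ _,
      fun x => ⟨x, Subsingleton.elim (α := B) _ _⟩⟩

end Perfection

/-! ### Equations for the stabilizer scheme -/

section Universal
variable (p : ℕ) [Fact p.Prime] (n : ℕ) {N h : ℕ} (hN : N < h)

/-- Coordinates on triples of `n × n` matrices over `W_h(R)`, and one more coordinate. -/
abbrev StabCoord (n h : ℕ) : Type := Option (Fin 3 × Fin n × Fin n × Fin h)

variable {R S : Type u} [CommRing R] [CommRing S]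

/-- The `a`-th matrix over `W_h(R)` with given coordinates. -/
def coordMatrix (s : StabCoord n h → R) (a : Fin 3) :
    Matrix (Fin n) (Fin n) (TruncatedWittVector p h R) :=
  Matrix.of fun i j => TruncatedWittVector.mk p fun l => s (some (a, i, j, l))

theorem coordMatrix_map (f : R →+* S) (s : StabCoord n h → R) (a : Fin 3) :
    (coordMatrix p n s a).map (truncMap p h f) = coordMatrix p n (f ∘ s) a := by
  ext i j l
  simp [coordMatrix]

/-- The equations on matrices `A, γ, γ'` and `t ∈ R` that say that `Aγ = A`, `γγ' = γ'γ = 1`,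
`det₀ A = ⋯ = det_{N-1} A = 0` and `t det_N A = 1`. -/
noncomputable def stabEquation (s : StabCoord n h → R) :
    Fin h ⊕ Unit ⊕ Fin 3 × Fin n × Fin n × Fin h → R
  -- The components from `N` on contribute the trivial equation `0 = 0` here.
  | .inl i => if i.val < N then (coordMatrix p n s 0).det.coeff i else 0
  | .inr (.inl _) => s none * (coordMatrix p n s 0).det.coeff ⟨N, hN⟩ - 1
  | .inr (.inr (0, i, j, l)) =>
    ((coordMatrix p n s 0 * coordMatrix p n s 1) i j).coeff l - (coordMatrix p n s 0 i j).coeff l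
  | .inr (.inr (1, i, j, l)) =>
    ((coordMatrix p n s 1 * coordMatrix p n s 2) i j).coeff l -
      ((1 : Matrix (Fin n) (Fin n) (TruncatedWittVector p h R)) i j).coeff l
  | .inr (.inr (2, i, j, l)) =>
    ((coordMatrix p n s 2 * coordMatrix p n s 1) i j).coeff l -
      ((1 : Matrix (Fin n) (Fin n) (TruncatedWittVector p h R)) i j).coeff l

/-- `truncMap` is a ring homomorphism acting by `f` on components, so it commutes with the
determinants and products that define the equations. This naturality stands in for writing them as
explicit polynomials. -/
theorem map_stabEquation (f : R →+* S) (s : StabCoord n h → R) (r) :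
    f (stabEquation p n hN s r) = stabEquation p n hN (f ∘ s) r := by
  have hdet (i : Fin h) : f ((coordMatrix p n s 0).det.coeff i) =
      (coordMatrix p n (f ∘ s) 0).det.coeff i := by
    rw [← coordMatrix_map]
    exact (truncMap_coeff p h f _ i).symm.trans
      (congrArg (fun x => TruncatedWittVector.coeff i x) (RingHom.map_det (truncMap p h f) _))
  have hmul (a b : Fin 3) (i j : Fin n) (l : Fin h) :
      f (((coordMatrix p n s a * coordMatrix p n s b) i j).coeff l) =
        ((coordMatrix p n (f ∘ s) a * coordMatrix p n (f ∘ s) b) i j).coeff l := by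
    rw [← coordMatrix_map, ← coordMatrix_map, ← Matrix.map_mul, Matrix.map_apply, truncMap_coeff]
  have hone (i j : Fin n) (l : Fin h) :
      f (((1 : Matrix (Fin n) (Fin n) (TruncatedWittVector p h R)) i j).coeff l) =
        ((1 : Matrix (Fin n) (Fin n) (TruncatedWittVector p h S)) i j).coeff l :=
    (truncMap_coeff p h f _ l).symm.trans (congrArg (fun M => (M i j).coeff l)
      (Matrix.map_one _ (map_zero (truncMap p h f)) (map_one (truncMap p h f))))
  match r with
  | .inl i =>
    simp only [stabEquation]
    split_ifs
    · exact hdet i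
    · exact map_zero f
  | .inr (.inl _) => simp only [stabEquation, map_sub, map_mul, map_one, hdet, Function.comp_apply]
  | .inr (.inr (0, i, j, l)) =>
    simp only [stabEquation, map_sub, hmul]
    rw [← coordMatrix_map p n f s 0]
    simp
  | .inr (.inr (1, i, j, l)) => simp only [stabEquation, map_sub, hmul, hone]
  | .inr (.inr (2, i, j, l)) => simp only [stabEquation, map_sub, hmul, hone]

theorem matrix_eq_of_coeff {p n h : ℕ} {R : Type*} [CommRing R]
    {M M' : Matrix (Fin n) (Fin n) (TruncatedWittVector p h R)}
    (H : ∀ i j l, (M i j).coeff l - (M' i j).coeff l = 0) : M = M' := by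
  ext i j l
  exact sub_eq_zero.1 (H i j l)

/-- The pair `(A, γ)` with given coordinates. -/
noncomputable def stabPoint (s : StabCoord n h → R) (hs : ∀ r, stabEquation p n hN s r = 0) :
    StabPoints p n hN R :=
  ⟨(coordMatrix p n s 0, ⟨coordMatrix p n s 1, coordMatrix p n s 2,
      matrix_eq_of_coeff fun i j l => hs (.inr (.inr (1, i, j, l))),
      matrix_eq_of_coeff fun i j l => hs (.inr (.inr (2, i, j, l)))⟩),
    ⟨fun i hi => by simpa [stabEquation, hi] using hs (.inl i),
      .of_mul_eq_one_right (s none) (sub_eq_zero.1 (hs (.inr (.inl ()))))⟩,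
    matrix_eq_of_coeff fun i j l => hs (.inr (.inr (0, i, j, l)))⟩

theorem map_stabPoint (f : R →+* S) (s : StabCoord n h → R)
    (hs : ∀ r, stabEquation p n hN s r = 0) :
    StabPoints.map p n hN f (stabPoint p n hN s hs) =
      stabPoint p n hN (f ∘ s) fun r => by rw [← map_stabEquation, hs, map_zero] :=
  Subtype.ext (Prod.ext (coordMatrix_map p n f s 0) (Units.ext (coordMatrix_map p n f s 1)))

theorem coordMatrix_apply_eq {p n h : ℕ} {R : Type*} {s t : StabCoord n h → R} {a : Fin 3}
    (H : coordMatrix p n s a = coordMatrix p n t a) (i j : Fin n) (l : Fin h) :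
    s (some (a, i, j, l)) = t (some (a, i, j, l)) := by
  have := congrArg (fun M => (M i j).coeff l) H
  simpa [coordMatrix] using this

/-- The auxiliary coordinates, for `γ⁻¹` and the inverse of `det_N A`, are inverses and hence
determined by `A` and `γ`. -/
theorem stabPoint_injective {s t : StabCoord n h → R} {hs : ∀ r, stabEquation p n hN s r = 0}
    {ht : ∀ r, stabEquation p n hN t r = 0} (H : stabPoint p n hN s hs = stabPoint p n hN t ht) :
    s = t := by
  have h0 : coordMatrix p n s 0 = coordMatrix p n t 0 := congrArg (fun x => x.1.1) H
  have h1 : coordMatrix p n s 1 = coordMatrix p n t 1 := congrArg (fun x => x.1.2.val) H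
  have h2 : coordMatrix p n s 2 = coordMatrix p n t 2 := congrArg (fun x => x.1.2.inv) H
  funext c
  match c with
  | none =>
    have e1 := sub_eq_zero.1 (hs (.inr (.inl ())))
    have e2 := sub_eq_zero.1 (ht (.inr (.inl ())))
    rw [← h0] at e2
    exact left_inv_eq_right_inv e1 ((mul_comm _ _).trans e2)
  | some (0, i, j, l) => exact coordMatrix_apply_eq h0 i j l
  | some (1, i, j, l) => exact coordMatrix_apply_eq h1 i j l
  | some (2, i, j, l) => exact coordMatrix_apply_eq h2 i j l

theorem exists_stabPoint_eq (x : StabPoints p n hN R) :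
    ∃ s hs, stabPoint p n hN s hs = x := by
  obtain ⟨⟨A, γ⟩, ⟨hA, hu⟩, hγ⟩ := x
  let M : Fin 3 → Matrix (Fin n) (Fin n) (TruncatedWittVector p h R) := ![A, γ.val, γ.inv]
  let s : StabCoord n h → R
    | none => (↑hu.unit⁻¹ : R)
    | some (a, i, j, l) => (M a i j).coeff l
  have hM (a : Fin 3) : coordMatrix p n s a = M a := by
    ext i j l
    simp [coordMatrix, s]
  have hs : ∀ r, stabEquation p n hN s r = 0 := by
    intro r
    match r with
    | .inl i =>
      simp only [stabEquation, hM]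
      split_ifs with hi
      · exact hA i hi
      · rfl
    | .inr (.inl _) =>
      simp only [stabEquation, hM]
      exact sub_eq_zero.2 hu.val_inv_mul
    | .inr (.inr (0, i, j, l)) =>
      simp only [stabEquation, hM]
      exact sub_eq_zero.2 (congrArg (fun M => (M i j).coeff l) hγ)
    | .inr (.inr (1, i, j, l)) =>
      simp only [stabEquation, hM]
      exact sub_eq_zero.2 (congrArg (fun M => (M i j).coeff l) γ.val_inv)
    | .inr (.inr (2, i, j, l)) =>
      simp only [stabEquation, hM]
      exact sub_eq_zero.2 (congrArg (fun M => (M i j).coeff l) γ.inv_val)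
  exact ⟨s, hs, Subtype.ext (Prod.ext (hM 0) (Units.ext (hM 1)))⟩

/-- Pairs `(A, γ)` are represented, on all `k`-algebras, by a `k`-algebra of finite type. -/
theorem exists_finiteType_universal (k : Type u) [Field k] :
    ∃ (B : CommAlgCat.{u} k) (x : StabPoints p n hN B), Algebra.FiniteType k B ∧
      ∀ (R : Type u) [CommRing R] [Algebra k R], Function.Bijective
        fun f : B →ₐ[k] R => StabPoints.map p n hN f.toRingHom x := by
  let P := MvPolynomial (StabCoord n h) k
  -- Evaluating the equations at the variables yields the defining polynomials; naturality recovers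
  -- their values at any other point.
  let I : Ideal P := Ideal.span (Set.range (stabEquation p n hN MvPolynomial.X))
  let s : StabCoord n h → P ⧸ I := Ideal.Quotient.mk I ∘ MvPolynomial.X
  have hs : ∀ r, stabEquation p n hN s r = 0 := by
    intro r
    rw [← map_stabEquation, Ideal.Quotient.eq_zero_iff_mem]
    exact Ideal.subset_span ⟨r, rfl⟩
  refine ⟨CommAlgCat.of k (P ⧸ I), stabPoint p n hN s hs, ?_, fun R _ _ => ⟨?_, ?_⟩⟩
  · exact Algebra.FiniteType.of_surjective (Ideal.Quotient.mkₐ k I)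
      (Ideal.Quotient.mkₐ_surjective k I)
  · intro f g e
    simp only [map_stabPoint] at e
    have := stabPoint_injective p n hN e
    refine Ideal.Quotient.algHom_ext k (MvPolynomial.algHom_ext fun c => congrFun this c)
  · intro x
    obtain ⟨t, ht, rfl⟩ := exists_stabPoint_eq p n hN x
    have hI : ∀ a ∈ I, MvPolynomial.aeval (R := k) t a = 0 := by
      change I ≤ RingHom.ker (MvPolynomial.aeval (R := k) t)
      rw [Ideal.span_le]
      rintro _ ⟨r, rfl⟩
      have := map_stabEquation p n hN (MvPolynomial.aeval (R := k) t).toRingHom MvPolynomial.X r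
      refine this.trans ?_
      convert ht r
      ext c
      simp
    refine ⟨Ideal.Quotient.liftₐ I (MvPolynomial.aeval t) hI, ?_⟩
    simp only [map_stabPoint]
    congr 1
    ext c
    exact MvPolynomial.aeval_X t c

end Universal

/-! ### Representability on perfect algebras -/

section Representable
variable (p : ℕ) [Fact p.Prime] (k : Type u) [Field k] [CharP k p] (n : ℕ) {N h : ℕ} (hN : N < h)

/-- The stabilizer scheme is perfect affine and perfectly of finite type. -/
theorem stabFunctor_representable :
    ∃ A : PerfAlg.{u} k p, IsPerfectlyFiniteType k p A ∧
      Nonempty (coyoneda.obj (Opposite.op A) ≅ stabFunctor p k n hN) := by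
  obtain ⟨B, x, hB, hx⟩ := exists_finiteType_universal p n hN k
  obtain ⟨A, i, hi, hA⟩ := exists_perfection p k B
  -- The universal pair over `B`, pushed to its perfection `A`, stays universal for perfect `R`:
  -- maps `B → R` extend uniquely to `A`.
  have hbij (R : PerfAlg.{u} k p) : Function.Bijective fun f : A ⟶ R =>
      StabPoints.map p n hN f.hom.hom.toRingHom (StabPoints.map p n hN i.toRingHom x) := by
    have key (f : A ⟶ R) : StabPoints.map p n hN f.hom.hom.toRingHom
        (StabPoints.map p n hN i.toRingHom x) =
        StabPoints.map p n hN (f.hom.hom.comp i).toRingHom x :=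
      (StabPoints.map_comp p n hN i.toRingHom f.hom.hom.toRingHom x).symm
    constructor
    · intro f g e
      have e := (hx R.obj).1 ((key f).symm.trans (Eq.trans e (key g)))
      have := (hA R (f.hom.hom.comp i)).unique rfl e.symm
      ext1
      exact CommAlgCat.hom_ext this
    · intro y
      obtain ⟨f, hf⟩ := (hx R.obj).2 y
      obtain ⟨g, hg, -⟩ := hA R f
      refine ⟨⟨CommAlgCat.ofHom g⟩, (key _).trans ?_⟩
      rw [← hf, ← hg]
      rfl
  refine ⟨A, ⟨B, i, hB, hi⟩, ⟨NatIso.ofComponents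
    (fun R => (Equiv.ofBijective _ (hbij R)).toIso) fun {R S} f => ?_⟩⟩
  ext g
  exact StabPoints.map_comp p n hN g.hom.hom.toRingHom f.hom.hom.toRingHom _

end Representable

end LevelGr

theorem mainTheorem3 (p : ℕ) [Fact p.Prime] (k : Type u) [Field k] [CharP k p] [PerfectRing k p]
    (n N h : ℕ) (hN : N < h) :
    (∃ e : LevelGr.stabFunctor p k n hN ⋙ uliftFunctor.{u + 1, u} ≅
        LevelGr.grFunctor p k n N h,
      ∀ (R : LevelGr.PerfAlg.{u} k p) (x : LevelGr.StabPoints p n hN R.obj),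
        LevelGr.GrPoints.matrix p n N h (e.hom.app R (ULift.up x)) = x.1.1) ∧
    ∃ A : LevelGr.PerfAlg.{u} k p, LevelGr.IsPerfectlyFiniteType k p A ∧
      Nonempty (coyoneda.obj (Opposite.op A) ⋙ uliftFunctor.{u + 1, u} ≅
        LevelGr.grFunctor p k n N h) := by
  refine ⟨⟨LevelGr.stabIsoGr p k n hN, LevelGr.matrix_stabIsoGr hN⟩, ?_⟩
  obtain ⟨A, hA, ⟨e⟩⟩ := LevelGr.stabFunctor_representable p k n hN
  exact ⟨A, hA, ⟨Functor.isoWhiskerRight e _ ≪≫ LevelGr.stabIsoGr p k n hN⟩⟩
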